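/- Let $n,p\ge 0$ be integers and $a,c$ real with $c>0$. View $M=S^{2n+1}\times S^{2p+1}\subset\mathbb C^{n+1}\times\mathbb C^{p+1}$ as the homogeneous space $U(n+1)/U(n)\times U(p+1)/U(p)$ with base point $o=(e_0,e_0)$. Write $Z_{\nu\mu}=E_{\nu\mu}-E_{\mu\nu}$, $T_{\nu\mu}=E_{\nu\mu}+E_{\mu\nu}$ for $(n+1)\times(n+1)$ matrices (indices $0,\dots,n$), and put $X^1=\tfrac12 iT_{00}$, $Y^1_{2\nu-1}=Z_{\nu0}$, $Y^1_{2\nu}=iT_{\nu0}$ ($1\le\nu\le n$) in $\mathfrak u(n+1)$; define $X^2$, $Y^2_{2\nu-1}$, $Y^2_{2\nu}$ ($1\le\nu\le p$) in $\mathfrak u(p+1)$ in the same way. Let $\mathfrak p$ be the real span of all these vectors, so that $\mathfrak u(n+1)\times\mathfrak u(p+1)=\mathfrak h\oplus\mathfrak p$ with $\mathfrak h=\mathfrak u(n)\times\mathfrak u(p)$, and let $[\cdot,\cdot]_{\mathfrak p}$ be the $\mathfrak p$-component of the commutator. Let $g(a,c)$ be the $U(n+1)\times U(p+1)$-invariant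 Riemannian metric $g(a,c)(X,Y)=\omega(X,I(a,c)Y)$ on $M$, where the invariant $2$-form $\omega$ and the invariant complex structure $I(a,c)$ are given on $\mathfrak p\cong T_oM$ by $$\omega=X^1\wedge X^2+\sum_{\nu=1}^nY^1_{2\nu-1}\wedge Y^1_{2\nu}+\sum_{\nu=1}^pY^2_{2\nu-1}\wedge Y^2_{2\nu},$$ $$I(a,c)X^1=\tfrac acX^1+\tfrac1cX^2,\quad I(a,c)X^2=-\tfrac{a^2+c^2}{c}X^1-\tfrac acX^2,\quad I(a,c)Y^j_{2\nu-1}=Y^j_{2\nu}\quad (j=1,2).$$ (Thus $g(X^1,X^1)=\tfrac1c$, $g(X^1,X^2)=-\tfrac ac$, $g(X^2,X^2)=\tfrac{a^2+c^2}{c}$, the vectors $Y^j_k$ are orthonormal, and they are orthogonal to $X^1,X^2$.) Then the Riemannian (Levi-Civita) connection $\nabla$ of $g(a,c)$ exists and is the invariant connection that corresponds to $$D_XY=\tfrac12[X,Y]_{\mathfrak p}+U(X,Y),\qquad X,Y\in\mathfrak p,$$ where $U:\mathfrak p\times\mathfrak p\to\mathfrak p$ is the symmetric bilinear map with $$U(X^1,Y^1_{2\nu-1})=\tfrac{2-c}{2c}Y^1_{2\nu},\qquad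 U(X^1,Y^1_{2\nu})=-\tfrac{2-c}{2c}Y^1_{2\nu-1},$$ $$U(X^1,Y^2_{2\nu-1})=-\tfrac acY^2_{2\nu},\qquad U(X^1,Y^2_{2\nu})=\tfrac acY^2_{2\nu-1},$$ $$U(X^2,Y^1_{2\nu-1})=-\tfrac acY^1_{2\nu},\qquad U(X^2,Y^1_{2\nu})=\tfrac acY^1_{2\nu-1},$$ $$U(X^2,Y^2_{2\nu-1})=\Big(\tfrac{a^2+c^2}{c}-\tfrac12\Big)Y^2_{2\nu},\qquad U(X^2,Y^2_{2\nu})=-\Big(\tfrac{a^2+c^2}{c}-\tfrac12\Big)Y^2_{2\nu-1},$$ and $U=0$ on all other unordered pairs of basis vectors. Here $\nabla$ corresponds to $D$ in the usual sense for reductive homogeneous spaces: writing $Z^*$ for the fundamental vector field of $Z$ (the velocity of $\exp(tZ)x$ at $t=0$), for all $k\in U(n+1)\times U(p+1)$, all $X,Y\in\mathfrak p$ and every vector field $V$ differentiable at $ko$ with $V(ko)=(\mathrm{Ad}_kY)^*(ko)$, $$\big(\nabla_{(\mathrm{Ad}_kX)^*}V-[(\mathrm{Ad}_kX)^*,V]\big)(ko)=(\mathrm{Ad}_kD_XY)^*(ko).$$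 -/

import Mathlib

open Manifold ContDiff Matrix

noncomputable section

namespace SphereProduct

/-! ### The manifold `S^{2n+1} × S^{2p+1}` -/

/-- `ℂ^{n+1}` with its standard Hermitian inner product. -/
abbrev CSpace (n : ℕ) := EuclideanSpace ℂ (Fin (n + 1))

instance finrankFact (n : ℕ) : Fact (Module.finrank ℝ (CSpace n) = (2 * n + 1) + 1) :=
  ⟨by rw [finrank_real_of_complex, finrank_euclideanSpace_fin]; ring⟩

/-- The unit sphere `S^{2n+1}` of `ℂ^{n+1}`. -/
abbrev OddSphere (n : ℕ) := Metric.sphere (0 : CSpace n) 1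

/-- The manifold `S^{2n+1} × S^{2p+1}`. -/
abbrev Mfd (n p : ℕ) := OddSphere n × OddSphere p

/-- The model vector space of `S^{2n+1} × S^{2p+1}`. -/
abbrev ModelE (n p : ℕ) :=
  EuclideanSpace ℝ (Fin (2 * n + 1)) × EuclideanSpace ℝ (Fin (2 * p + 1))

/-- The model with corners of `S^{2n+1} × S^{2p+1}`. -/
abbrev ModelI (n p : ℕ) := (𝓡 (2 * n + 1)).prod (𝓡 (2 * p + 1))

/-- The tangent space of `S^{2n+1} × S^{2p+1}` at `x`. -/
abbrev Tan {n p : ℕ} (x : Mfd n p) := TangentSpace (ModelI n p) x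

/-! ### The group `U(n+1) × U(p+1)`, its Lie algebra and its action -/

/-- The group `U(n+1)`. -/
abbrev UGrp (n : ℕ) := Matrix.unitaryGroup (Fin (n + 1)) ℂ

/-- The Lie algebra `𝔲(n+1)` of skew-Hermitian matrices. -/
def uLie (n : ℕ) : Submodule ℝ (Matrix (Fin (n + 1)) (Fin (n + 1)) ℂ) where
  carrier := {A | Aᴴ = -A}
  add_mem' {A B} hA hB := by
    simp only [Set.mem_ofPred_eq] at hA hB ⊢
    rw [conjTranspose_add, hA, hB]; abel
  zero_mem' := by simp
  smul_mem' r A hA := by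
    simp only [Set.mem_ofPred_eq] at hA ⊢
    rw [conjTranspose_smul, hA]; simp

theorem mem_uLie {n : ℕ} {A : Matrix (Fin (n + 1)) (Fin (n + 1)) ℂ} :
    A ∈ uLie n ↔ Aᴴ = -A := Iff.rfl

/-- The commutator bracket of `𝔲(n+1)`. -/
def uBracket {n : ℕ} (A B : uLie n) : uLie n :=
  ⟨A.1 * B.1 - B.1 * A.1, by
    rw [mem_uLie, conjTranspose_sub, conjTranspose_mul, conjTranspose_mul,
      mem_uLie.1 A.2, mem_uLie.1 B.2]
    noncomm_ring⟩

/-- The Lie algebra `𝔤 = 𝔲(n+1) × 𝔲(p+1)` of `U(n+1) × U(p+1)`. -/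
abbrev gLie (n p : ℕ) := uLie n × uLie p

/-- The Lie bracket of `𝔤`. -/
def gBracket {n p : ℕ} (A B : gLie n p) : gLie n p := (uBracket A.1 B.1, uBracket A.2 B.2)

theorem norm_mulVec_unitary {n : ℕ} (k : UGrp n) (x : CSpace n) :
    ‖(WithLp.toLp 2 (k.1 *ᵥ x.ofLp) : CSpace n)‖ = ‖x‖ := by
  have hk : (k.1)ᴴ * k.1 = 1 := mem_unitaryGroup_iff'.1 k.2
  have h : inner ℂ (WithLp.toLp 2 (k.1 *ᵥ x.ofLp) : CSpace n)
      (WithLp.toLp 2 (k.1 *ᵥ x.ofLp) : CSpace n) = inner ℂ x x := by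
    rw [EuclideanSpace.inner_eq_star_dotProduct, EuclideanSpace.inner_eq_star_dotProduct]
    rw [star_mulVec, dotProduct_comm, ← dotProduct_mulVec, mulVec_mulVec, hk, one_mulVec,
      dotProduct_comm]
  rw [@norm_eq_sqrt_re_inner ℂ, @norm_eq_sqrt_re_inner ℂ, h]

/-- The action of `U(n+1)` on the unit sphere of `ℂ^{n+1}`. -/
def rotate {n : ℕ} (k : UGrp n) (x : OddSphere n) : OddSphere n :=
  ⟨WithLp.toLp 2 (k.1 *ᵥ x.1.ofLp), by
    rw [mem_sphere_zero_iff_norm, norm_mulVec_unitary]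
    exact mem_sphere_zero_iff_norm.1 x.2⟩

/-- The action of `U(n+1) × U(p+1)` on `S^{2n+1} × S^{2p+1}`. -/
def act {n p : ℕ} (k : UGrp n × UGrp p) (x : Mfd n p) : Mfd n p :=
  (rotate k.1 x.1, rotate k.2 x.2)

/-- The one-parameter subgroup `t ↦ exp(tA)` of `U(n+1)`. -/
def expU {n : ℕ} (A : uLie n) (t : ℝ) : UGrp n :=
  ⟨NormedSpace.exp (t • A.1), by
    rw [mem_unitaryGroup_iff, star_eq_conjTranspose, ← exp_conjTranspose, conjTranspose_smul,
      mem_uLie.1 A.2, star_trivial, smul_neg, exp_neg]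
    exact mul_nonsing_inv _ ((isUnit_iff_isUnit_det _).1 (isUnit_exp _))⟩

/-- The adjoint action `Ad_k A = k A k⁻¹` of `U(n+1)` on its Lie algebra. -/
def adU {n : ℕ} (k : UGrp n) (A : uLie n) : uLie n :=
  ⟨k.1 * A.1 * (k.1)ᴴ, by
    rw [mem_uLie, conjTranspose_mul, conjTranspose_mul, conjTranspose_conjTranspose,
      mem_uLie.1 A.2]
    noncomm_ring⟩

/-- The adjoint action of `U(n+1) × U(p+1)` on `𝔤`. -/
def adG {n p : ℕ} (k : UGrp n × UGrp p) (A : gLie n p) : gLie n p :=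
  (adU k.1 A.1, adU k.2 A.2)

/-- The fundamental vector field `A*` of `A ∈ 𝔤`: its value at `x` is the velocity
at `t = 0` of the curve `t ↦ exp(tA) x`. -/
def fund {n p : ℕ} (A : gLie n p) (x : Mfd n p) : Tan x :=
  mfderiv 𝓘(ℝ, ℝ) (ModelI n p) (fun t : ℝ => act (expU A.1 t, expU A.2 t) x) 0 (1 : ℝ)

/-- The base point `o = (e₀, e₀)`, whose stabilizer is `U(n) × U(p)`. -/
def base (n p : ℕ) : Mfd n p :=
  (⟨EuclideanSpace.single 0 1, by simp⟩, ⟨EuclideanSpace.single 0 1, by simp⟩)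

/-! ### The reductive decomposition `𝔤 = 𝔥 ⊕ 𝔭` -/

/-- `Z_{νμ} = E_{νμ} - E_{μν}`. -/
def matZ {n : ℕ} (ν μ : Fin (n + 1)) : Matrix (Fin (n + 1)) (Fin (n + 1)) ℂ :=
  Matrix.single ν μ 1 - Matrix.single μ ν 1

/-- `T_{νμ} = E_{νμ} + E_{μν}`. -/
def matT {n : ℕ} (ν μ : Fin (n + 1)) : Matrix (Fin (n + 1)) (Fin (n + 1)) ℂ :=
  Matrix.single ν μ 1 + Matrix.single μ ν 1

/-- `X = ½ i T₀₀`. -/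
def uX (n : ℕ) : uLie n :=
  ⟨(1 / 2 * Complex.I) • matT 0 0, by
    rw [mem_uLie, matT, conjTranspose_smul, conjTranspose_add, conjTranspose_single]
    simp⟩

/-- `Y_{2ν-1} = Z_{ν0}`; here `ν : Fin n` stands for the index `ν + 1 ∈ {1, …, n}`. -/
def uYodd {n : ℕ} (ν : Fin n) : uLie n :=
  ⟨matZ ν.succ 0, by
    rw [mem_uLie, matZ, conjTranspose_sub, conjTranspose_single, conjTranspose_single]
    simp⟩

/-- `Y_{2ν} = i T_{ν0}`; here `ν : Fin n` stands for the index `ν + 1 ∈ {1, …, n}`. -/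
def uYeven {n : ℕ} (ν : Fin n) : uLie n :=
  ⟨Complex.I • matT ν.succ 0, by
    rw [mem_uLie, matT, conjTranspose_smul, conjTranspose_add, conjTranspose_single,
      conjTranspose_single]
    simp [add_comm]⟩

/-- The complement of `𝔲(n)` in `𝔲(n+1)`: the span of `X` and all `Y_{2ν-1}`, `Y_{2ν}`. -/
def uP (n : ℕ) : Submodule ℝ (uLie n) :=
  Submodule.span ℝ ({uX n} ∪ Set.range uYodd ∪ Set.range uYeven)

/-- `𝔭 = 𝔭₁ × 𝔭₂`. -/
def pLie (n p : ℕ) : Submodule ℝ (gLie n p) := (uP n).prod (uP p)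

/-- `𝔲(n) ⊆ 𝔲(n+1)`: the skew-Hermitian matrices whose zeroth row and column vanish. -/
def uH (n : ℕ) : Submodule ℝ (uLie n) where
  carrier := {A | ∀ i, A.1 i 0 = 0 ∧ A.1 0 i = 0}
  add_mem' {A B} hA hB i := by simp [hA i, hB i]
  zero_mem' i := by simp
  smul_mem' r A hA i := by simp [hA i]

/-- The `𝔭`-component of `A ∈ 𝔲(n+1)` (see `uProj_mem` and `sub_uProj_mem`): the entries
outside the zeroth row and column are replaced by `0`. -/
def uProj {n : ℕ} (A : uLie n) : uLie n :=
  ⟨Matrix.of fun i j => if i = 0 ∨ j = 0 then A.1 i j else 0, by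
    rw [mem_uLie]
    ext i j
    have h := congrFun (congrFun (mem_uLie.1 A.2) i) j
    simp only [conjTranspose_apply, Matrix.neg_apply, Matrix.of_apply] at h ⊢
    by_cases hi : i = 0 <;> by_cases hj : j = 0 <;> simp_all⟩

theorem uProj_mem {n : ℕ} (A : uLie n) : uProj A ∈ uP n := by
  have h00 : (A.1 0 0).re = 0 := by
    have h := congrArg Complex.re (congrFun (congrFun (mem_uLie.1 A.2) 0) 0)
    simp only [conjTranspose_apply, Matrix.neg_apply, Complex.star_def, Complex.conj_re,
      Complex.neg_re] at h
    linarith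
  have key : uProj A = (A.1 0 0).im • uX n
      + ∑ ν : Fin n, ((A.1 ν.succ 0).re • uYodd ν + (A.1 ν.succ 0).im • uYeven ν) := by
    have hs : ∀ i j, A.1 j i = -(starRingEnd ℂ) (A.1 i j) := fun i j => by
      have h := congrFun (congrFun (mem_uLie.1 A.2) j) i
      simp only [conjTranspose_apply, Matrix.neg_apply, Complex.star_def] at h
      rw [h, neg_neg]
    ext i j
    simp only [uProj, uX, uYodd, uYeven, matT, matZ, Matrix.of_apply, Submodule.coe_add,
      Submodule.coe_smul, Submodule.coe_sum, Matrix.add_apply, Matrix.smul_apply,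
      Matrix.sum_apply, Matrix.sub_apply]
    refine Fin.cases ?_ (fun i => ?_) i <;> refine Fin.cases ?_ (fun j => ?_) j
    · apply Complex.ext <;> simp [h00]; ring
    · rw [hs j.succ 0]
      apply Complex.ext <;> simp [Matrix.single_apply, Finset.sum_add_distrib, (Fin.succ_ne_zero j).symm]
    · apply Complex.ext <;> simp [Matrix.single_apply, Finset.sum_add_distrib, (Fin.succ_ne_zero i).symm]
    · simp [(Fin.succ_ne_zero i).symm, (Fin.succ_ne_zero j).symm]
  rw [key]
  refine Submodule.add_mem _ (Submodule.smul_mem _ _ (Submodule.subset_span (by simp)))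
    (Submodule.sum_mem _ fun ν _ => Submodule.add_mem _
      (Submodule.smul_mem _ _ (Submodule.subset_span (by simp)))
      (Submodule.smul_mem _ _ (Submodule.subset_span (by simp))))

theorem sub_uProj_mem {n : ℕ} (A : uLie n) : A - uProj A ∈ uH n := by
  intro i
  simp [uProj]

/-- The `𝔭`-component `A_𝔭` of `A ∈ 𝔤 = 𝔥 ⊕ 𝔭`. -/
def gProj {n p : ℕ} (A : gLie n p) : gLie n p := (uProj A.1, uProj A.2)

theorem uX_mem (n : ℕ) : uX n ∈ uP n := Submodule.subset_span (by simp)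
theorem uYodd_mem {n : ℕ} (ν : Fin n) : uYodd ν ∈ uP n := Submodule.subset_span (by simp)
theorem uYeven_mem {n : ℕ} (ν : Fin n) : uYeven ν ∈ uP n := Submodule.subset_span (by simp)

section Basis

variable (n p : ℕ)

/-- The basis vector `X¹` of `𝔭`. -/
def X1 : pLie n p := ⟨(uX n, 0), uX_mem n, zero_mem _⟩
/-- The basis vector `X²` of `𝔭`. -/
def X2 : pLie n p := ⟨(0, uX p), zero_mem _, uX_mem p⟩
/-- The basis vectors `Y¹_{2ν-1}` of `𝔭`. -/
def Y1odd (ν : Fin n) : pLie n p := ⟨(uYodd ν, 0), uYodd_mem ν, zero_mem _⟩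
/-- The basis vectors `Y¹_{2ν}` of `𝔭`. -/
def Y1even (ν : Fin n) : pLie n p := ⟨(uYeven ν, 0), uYeven_mem ν, zero_mem _⟩
/-- The basis vectors `Y²_{2ν-1}` of `𝔭`. -/
def Y2odd (ν : Fin p) : pLie n p := ⟨(0, uYodd ν), zero_mem _, uYodd_mem ν⟩
/-- The basis vectors `Y²_{2ν}` of `𝔭`. -/
def Y2even (ν : Fin p) : pLie n p := ⟨(0, uYeven ν), zero_mem _, uYeven_mem ν⟩

/-- The set of all basis vectors `Y¹_j`, `Y²_j`. -/
def Yset : Set (pLie n p) :=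
  Set.range (Y1odd n p) ∪ Set.range (Y1even n p) ∪ Set.range (Y2odd n p) ∪ Set.range (Y2even n p)

end Basis

/-! ### The symmetric bilinear map `U` -/

/-- `U` is the symmetric bilinear map `𝔭 × 𝔭 → 𝔭` with the prescribed values on pairs of
basis vectors; up to the order of the arguments every pair of basis vectors is listed. -/
structure IsUMap {n p : ℕ} (a c : ℝ) (U : pLie n p →ₗ[ℝ] pLie n p →ₗ[ℝ] pLie n p) : Prop where
  symm : ∀ X Y, U X Y = U Y X
  X1_Y1odd : ∀ ν, U (X1 n p) (Y1odd n p ν) = ((2 - c) / (2 * c)) • Y1even n p ν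
  X1_Y1even : ∀ ν, U (X1 n p) (Y1even n p ν) = -((2 - c) / (2 * c)) • Y1odd n p ν
  X1_Y2odd : ∀ ν, U (X1 n p) (Y2odd n p ν) = -(a / c) • Y2even n p ν
  X1_Y2even : ∀ ν, U (X1 n p) (Y2even n p ν) = (a / c) • Y2odd n p ν
  X2_Y1odd : ∀ ν, U (X2 n p) (Y1odd n p ν) = -(a / c) • Y1even n p ν
  X2_Y1even : ∀ ν, U (X2 n p) (Y1even n p ν) = (a / c) • Y1odd n p ν
  X2_Y2odd : ∀ ν, U (X2 n p) (Y2odd n p ν) = ((a ^ 2 + c ^ 2) / c - 1 / 2) • Y2even n p ν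
  X2_Y2even : ∀ ν, U (X2 n p) (Y2even n p ν) = -((a ^ 2 + c ^ 2) / c - 1 / 2) • Y2odd n p ν
  X1_X1 : U (X1 n p) (X1 n p) = 0
  X1_X2 : U (X1 n p) (X2 n p) = 0
  X2_X2 : U (X2 n p) (X2 n p) = 0
  Y_Y : ∀ Y ∈ Yset n p, ∀ Y' ∈ Yset n p, U Y Y' = 0

/-! ### The invariant form `ω`, complex structure `I(a,c)` and metric `g(a,c)` -/

section Metric

variable {n p : ℕ}

/-- A tangent vector of `S^{2n+1} × S^{2p+1}`, seen in the first factor `ℂ^{n+1}`. -/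
def emb1 (x : Mfd n p) (u : Tan x) : CSpace n :=
  mfderiv (ModelI n p) 𝓘(ℝ, CSpace n) (fun y : Mfd n p => (y.1 : CSpace n)) x u

/-- A tangent vector of `S^{2n+1} × S^{2p+1}`, seen in the second factor `ℂ^{p+1}`. -/
def emb2 (x : Mfd n p) (u : Tan x) : CSpace p :=
  mfderiv (ModelI n p) 𝓘(ℝ, CSpace p) (fun y : Mfd n p => (y.2 : CSpace p)) x u

/-- A tangent vector at `x = (x₁, x₂)` is `(ξ₁ i x₁ + ζ₁, ξ₂ i x₂ + ζ₂)` with real `ξ_j` and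
with `ζ_j` in the Hermitian orthogonal complement of `x_j`. At the base point the vectors
`X¹`, `X²`, `Y¹_{2ν-1}`, `Y¹_{2ν}`, … of `𝔭` have all components `0` except `ξ₁ = 1`,
`ξ₂ = 1`, `ζ₁ = e_ν`, `ζ₁ = i e_ν`, … respectively, and the action of `k = (k₁, k₂)` fixes the
`ξ_j` and maps `ζ_j` to `k_j ζ_j`. -/
structure Components (n p : ℕ) where
  ξ₁ : ℝ
  ξ₂ : ℝ
  ζ₁ : CSpace n
  ζ₂ : CSpace p

/-- The components of a tangent vector. -/
def comps (x : Mfd n p) (u : Tan x) : Components n p where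
  ξ₁ := (inner ℂ (Complex.I • (x.1 : CSpace n)) (emb1 x u)).re
  ξ₂ := (inner ℂ (Complex.I • (x.2 : CSpace p)) (emb2 x u)).re
  ζ₁ := emb1 x u - (inner ℂ (x.1 : CSpace n) (emb1 x u)) • (x.1 : CSpace n)
  ζ₂ := emb2 x u - (inner ℂ (x.2 : CSpace p) (emb2 x u)) • (x.2 : CSpace p)

/-- `ω = X¹ ∧ X² + ∑ Y¹_{2ν-1} ∧ Y¹_{2ν} + ∑ Y²_{2ν-1} ∧ Y²_{2ν}`, extended invariantly. -/
def omega (s t : Components n p) : ℝ :=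
  (s.ξ₁ * t.ξ₂ - s.ξ₂ * t.ξ₁) + (inner ℂ (Complex.I • s.ζ₁) t.ζ₁).re
    + (inner ℂ (Complex.I • s.ζ₂) t.ζ₂).re

/-- The invariant complex structure `I(a,c)`:
`X¹ ↦ (a/c) X¹ + (1/c) X²`, `X² ↦ -((a²+c²)/c) X¹ - (a/c) X²`, `Y_{2ν-1} ↦ Y_{2ν}`,
`Y_{2ν} ↦ -Y_{2ν-1}`. -/
def cstr (a c : ℝ) (t : Components n p) : Components n p where
  ξ₁ := a / c * t.ξ₁ - (a ^ 2 + c ^ 2) / c * t.ξ₂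
  ξ₂ := 1 / c * t.ξ₁ - a / c * t.ξ₂
  ζ₁ := Complex.I • t.ζ₁
  ζ₂ := Complex.I • t.ζ₂

/-- The invariant metric `g(a,c)(u, v) = ω(u, I(a,c) v)` on `S^{2n+1} × S^{2p+1}`. -/
def metric (a c : ℝ) (x : Mfd n p) (u v : Tan x) : ℝ :=
  omega (comps x u) (cstr a c (comps x v))

end Metric

/-! ### Connections -/

section Connection

variable {n p : ℕ}

/-- Connections (covariant derivatives of vector fields) on `S^{2n+1} × S^{2p+1}`.
The value `∇ V x u` is `(∇_u V)(x)`. -/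
abbrev Connection (n p : ℕ) :=
  CovariantDerivative (ModelI n p) (ModelE n p) (fun x : Mfd n p => Tan x)

/-- The vector field `V` is differentiable at `x`. -/
def DiffAt (V : (x : Mfd n p) → Tan x) (x : Mfd n p) : Prop :=
  MDifferentiableAt (ModelI n p) ((ModelI n p).prod 𝓘(ℝ, ModelE n p))
    (fun y => (⟨y, V y⟩ : TangentBundle (ModelI n p) (Mfd n p))) x

/-- `∇` is a Riemannian (Levi-Civita) connection of `g`: it has no torsion, and
`u(g(V, W)) = g(∇_u V, W) + g(V, ∇_u W)`. -/
structure IsRiemannianConnection (g : (x : Mfd n p) → Tan x → Tan x → ℝ)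
    (D : Connection n p) : Prop where
  torsion_free : D.torsion = 0
  metric_compatible : ∀ (x : Mfd n p) (V W : (y : Mfd n p) → Tan y), DiffAt V x → DiffAt W x →
    ∀ u : Tan x,
      (mfderiv (ModelI n p) 𝓘(ℝ, ℝ) (fun y => g y (V y) (W y)) x u : ℝ)
        = g x (D V x u) (W x) + g x (V x) (D W x u)

/-- `∇` is the invariant connection on the reductive homogeneous space
`S^{2n+1} × S^{2p+1}` that corresponds to the map `L : 𝔭 × 𝔭 → 𝔭`, `(X, Y) ↦ D_X Y`.
At the base point `o` (the case `k = 1`) this means that the tensorial operator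
`V ↦ ∇_{X*} V - [X*, V]` maps `Y*(o)` to `(D_X Y)*(o)`; equivalently, `D_X Y` is the covariant
derivative at `t = 0` of the field `exp(tX)_* Y*(o)` along `t ↦ exp(tX) o`. For general `k` it is
the translate by `k` of this identity, as `k_*` maps `Z*(o)` to `(Ad_k Z)*(k o)`. -/
def IsInvariantConnectionOf (L : pLie n p → pLie n p → gLie n p) (D : Connection n p) : Prop :=
  ∀ (k : UGrp n × UGrp p) (X Y : pLie n p) (V : (x : Mfd n p) → Tan x),
    DiffAt V (act k (base n p)) →
    V (act k (base n p)) = fund (adG k Y.1) (act k (base n p)) →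
    D V (act k (base n p)) (fund (adG k X.1) (act k (base n p)))
        - VectorField.mlieBracket (ModelI n p) (fund (adG k X.1)) V (act k (base n p))
      = fund (adG k (L X Y)) (act k (base n p))

end Connection

end SphereProduct

end

/-!
The sphere product is embedded in `ℂ^{n+1} × ℂ^{p+1}`, and every tangent vector `u` at `x` is
replaced by its image `emb x u`. Each factor `u_j` is split as `ξ_j i x_j + ζ_j`, with `ξ_j` real
and `ζ_j` Hermitian orthogonal to `x_j`. In these terms `g(a,c)` is
the restriction of
`Re ⟨v, w⟩ + ξ₁(v) κ₁(w) + ξ₂(v) κ₂(w)`, where `κ₁ = (1/c - 1) ξ₁ - (a/c) ξ₂` and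
`κ₂ = ((a² + c²)/c - 1) ξ₂ - (a/c) ξ₁` measure the deviation from the round metric (`gform`,
`metric_eq`).

*Existence.* The Levi-Civita connection can be written down: `∇_u V` is the tangential part of
`dV(u) + Γ(V, u)`, with the symmetric tensor
`Γ(v, u)_j = i (κ_j(u) ζ_j(v) + κ_j(v) ζ_j(u))` (`christoffel`, `connection`). It has no torsion
since `Γ` is symmetric and the Lie bracket is the commutator of derivations
(`mvfderiv_mlieBracket`, `torsion_connection`). Differentiating the coefficients of `g` along `u`
gives the terms `Im ⟨u_j, v_j⟩ κ_j(w) + Im ⟨u_j, w_j⟩ κ_j(v)`, and these are exactly the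
contributions of `Γ` (`gform_covariant`, `mvfderiv_metric`).

*Uniqueness.* The difference of two Levi-Civita connections is a tensor `S(v, u)` that is symmetric
in `v, u` and for which `g(S(v, u), w)` is skew in `v, w`; so it vanishes, `g` being definite
(`IsRiemannianConnection.apply_eq`).

*The map `U`.* A fundamental field `A*` is the restriction of the linear field `y ↦ A y`
(`emb_fund`), so for `V(x) = B*(x)` the vector `∇_{A*} V - [A*, V]` is the tangential part of
`A B x + Γ(B x, A x)`: the derivatives of `V` cancel (`emb_connection_sub_mlieBracket`). At
`x = e₀` and for `A, B ∈ 𝔭` the tangential part of `A B e₀` is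
`½ [A, B]_𝔭 e₀ + ½ i (ξ(A) ζ(B e₀) + ξ(B) ζ(A e₀))` (`tproj_matOp_e0`), and `i ζ(A e₀)` is
`J(A) e₀` with `J(A) = [A, X]_𝔭`. Hence the sum is `(½ [A, B]_𝔭 + U(A, B)) e₀` with
`U(A, B)_j = α_j(A) J(B_j) + α_j(B) J(A_j)` and `α_j = κ_j + ½ ξ_j` (`uMap`). At `k e₀` the
identity is transported by the unitary operator `k` (`tproj_matOp_adU`).
-/

noncomputable section

namespace SphereProduct

/-! ### Vector fields in charts and the Lie bracket -/

section General

open VectorField Topology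

variable {E : Type*} [NormedAddCommGroup E] [NormedSpace ℝ E] {H : Type*} [TopologicalSpace H]
  {I : ModelWithCorners ℝ E H} {M : Type*} [TopologicalSpace M] [ChartedSpace H M]
  {F : Type*} [NormedAddCommGroup F] [NormedSpace ℝ F]

theorem hasFDerivAt_comp_extChartAt_symm [I.Boundaryless] {f : M → F} {x : M}
    (hf : MDifferentiableAt I 𝓘(ℝ, F) f x) :
    HasFDerivAt (f ∘ (extChartAt I x).symm) (mvfderiv I f x : E →L[ℝ] F) (extChartAt I x x) := by
  have key : ∀ A : E →L[ℝ] F,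
      HasFDerivWithinAt (f ∘ (extChartAt I x).symm) A (Set.range I) (extChartAt I x x) →
      HasFDerivAt (f ∘ (extChartAt I x).symm) A (extChartAt I x x) := by
    intro A h
    rwa [I.range_eq_univ, hasFDerivWithinAt_univ] at h
  exact key _ hf.hasMFDerivAt.2

/-- The curve through `x` that is a straight line with direction `u` in the preferred chart
at `x`. -/
def chartLine (I : ModelWithCorners ℝ E H) (x : M) (u : TangentSpace I x) (t : ℝ) : M :=
  let v : E := u
  (extChartAt I x).symm (extChartAt I x x + t • v)

theorem chartLine_zero (x : M) (u : TangentSpace I x) : chartLine I x u 0 = x := by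
  have h : ∀ v : E, (extChartAt I x).symm (extChartAt I x x + (0 : ℝ) • v) = x := by simp
  exact h u

theorem hasDerivAt_comp_chartLine [I.Boundaryless] {f : M → F} {x : M}
    (hf : MDifferentiableAt I 𝓘(ℝ, F) f x) (u : TangentSpace I x) :
    HasDerivAt (fun t => f (chartLine I x u t)) (mvfderiv I f x u) 0 := by
  have key : ∀ (A : E →L[ℝ] F) (v : E),
      HasFDerivAt (f ∘ (extChartAt I x).symm) A (extChartAt I x x) →
      HasDerivAt (fun t => f (chartLine I x v t)) (A v) 0 := by
    intro A v h
    have h2 : HasDerivAt (fun t : ℝ => extChartAt I x x + t • v) v 0 := by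
      simpa using ((hasDerivAt_id (0 : ℝ)).smul_const v).const_add (extChartAt I x x)
    have h3 : HasFDerivAt (f ∘ (extChartAt I x).symm) A (extChartAt I x x + (0 : ℝ) • v) := by
      simpa using h
    exact h3.comp_hasDerivAt (0 : ℝ) h2
  exact key _ u (hasFDerivAt_comp_extChartAt_symm hf)

/-- The derivative `V f` of a `C²` function along a field that is differentiable at `x` is again
differentiable at `x`. -/
theorem mdifferentiableAt_mvfderiv_apply [IsManifold I 2 M] {f : M → F}
    (hf : ContMDiff I 𝓘(ℝ, F) 2 f) {V : (y : M) → TangentSpace I y} {x : M}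
    (hV : MDifferentiableAt I I.tangent (fun y => (⟨y, V y⟩ : TangentBundle I M)) x) :
    MDifferentiableAt I 𝓘(ℝ, F) (fun y => mvfderiv I f y (V y)) x := by
  have h1 : ContMDiff I.tangent 𝓘(ℝ, F).tangent 1 (tangentMap I 𝓘(ℝ, F) f) :=
    hf.contMDiff_tangentMap le_rfl
  have h2 := (contMDiff_snd_tangentBundle_modelSpace (n := 1) F 𝓘(ℝ, F)).comp h1
  exact (h2.mdifferentiable one_ne_zero _).comp x hV

/-- The vector field `V`, read in the preferred chart at `x`. -/
def chartField (I : ModelWithCorners ℝ E H) (x : M) (V : (y : M) → TangentSpace I y) : E → E :=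
  mpullbackWithin 𝓘(ℝ, E) I (extChartAt I x).symm V (Set.range I)

theorem mvfderiv_apply_extChartAt_symm [I.Boundaryless] [IsManifold I 1 M] {f : M → F} {x : M}
    {y : E} (hy : y ∈ (extChartAt I x).target)
    (hf : MDifferentiableAt I 𝓘(ℝ, F) f ((extChartAt I x).symm y))
    (V : (y : M) → TangentSpace I y) :
    mvfderiv I f ((extChartAt I x).symm y) (V ((extChartAt I x).symm y)) =
      fderiv ℝ (f ∘ (extChartAt I x).symm) y (chartField I x V y) := by
  have hV : mfderivWithin 𝓘(ℝ, E) I (extChartAt I x).symm (Set.range I) y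
      (mpullbackWithin 𝓘(ℝ, E) I (extChartAt I x).symm V (Set.range I) y)
      = V ((extChartAt I x).symm y) := by
    rw [mpullbackWithin_apply]
    exact (isInvertible_mfderivWithin_extChartAt_symm hy).self_apply_inverse _
  rw [← hV]
  have h1 := mdifferentiableWithinAt_extChartAt_symm (I := I) hy
  rw [chartField]
  rw [I.range_eq_univ] at *
  rw [mdifferentiableWithinAt_univ] at h1
  rw [mfderivWithin_univ, ← mfderiv_eq_fderiv, mfderiv_comp _ hf h1]
  rfl

theorem differentiableAt_chartField [I.Boundaryless] [IsManifold I 2 M] [CompleteSpace E]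
    {V : (y : M) → TangentSpace I y} {x : M}
    (hV : MDifferentiableAt I I.tangent (fun y => (⟨y, V y⟩ : TangentBundle I M)) x) :
    DifferentiableAt ℝ (chartField I x V) (extChartAt I x x) := by
  have h : DifferentiableWithinAt ℝ (chartField I x V)
      ((extChartAt I x).symm ⁻¹' Set.univ ∩ Set.range I) (extChartAt I x x) :=
    MDifferentiableWithinAt.differentiableWithinAt_mpullbackWithin_vectorField
      (mdifferentiableWithinAt_univ.2 hV)
  rwa [I.range_eq_univ, Set.preimage_univ, Set.univ_inter, differentiableWithinAt_univ] at h

/-- The derivative of `f` along `[V, W]` is computed in the preferred chart at `x`. No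
differentiability of `V` and `W` is needed, as both sides use the same bracket of coordinate
fields. -/
theorem mvfderiv_mlieBracket_chart [I.Boundaryless] [IsManifold I 1 M]
    {f : M → F} {x : M} (hf : MDifferentiableAt I 𝓘(ℝ, F) f x)
    (V W : (y : M) → TangentSpace I y) :
    mvfderiv I f x (mlieBracket I V W x) =
      fderiv ℝ (f ∘ (extChartAt I x).symm) (extChartAt I x x)
        (lieBracket ℝ (chartField I x V) (chartField I x W) (extChartAt I x x)) := by
  have hx : (extChartAt I x).symm (extChartAt I x x) = x := extChartAt_to_inv x
  set A := mfderiv I 𝓘(ℝ, E) (extChartAt I x) x with hA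
  have hinv : A.IsInvertible := isInvertible_mfderiv_extChartAt (mem_extChartAt_source x)
  have hj : DifferentiableAt ℝ (f ∘ (extChartAt I x).symm) (extChartAt I x x) :=
    (hasFDerivAt_comp_extChartAt_symm hf).differentiableAt
  have hcomp : ∀ u : TangentSpace I x, mvfderiv I f x u =
      fderiv ℝ (f ∘ (extChartAt I x).symm) (extChartAt I x x) (A u) := by
    have he : f =ᶠ[𝓝 x] (f ∘ (extChartAt I x).symm) ∘ extChartAt I x := by
      filter_upwards [extChartAt_source_mem_nhds (I := I) x] with y hy
      simp only [Function.comp_apply, (extChartAt I x).left_inv hy]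
    intro u
    have h1 := (hj.hasFDerivAt.hasMFDerivAt.comp x
      (mdifferentiableAt_extChartAt (mem_chart_source H x)).hasMFDerivAt).congr_of_eventuallyEq he
    exact congrArg (fun B : TangentSpace I x →L[ℝ] F => B u) h1.mfderiv
  rw [hcomp]
  congr 1
  have h2 : mlieBracket I V W x = A.inverse (show TangentSpace 𝓘(ℝ, E) (extChartAt I x x) from
      (lieBracketWithin ℝ (chartField I x V : E → E) (chartField I x W)
        ((extChartAt I x).symm ⁻¹' Set.univ ∩ Set.range I) (extChartAt I x x) : E)) := rfl
  rw [I.range_eq_univ, Set.preimage_univ, Set.univ_inter, lieBracketWithin_univ] at h2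
  rw [h2]
  exact hinv.self_apply_inverse _

/-- The Lie bracket of vector fields acts on functions as the commutator of derivations. -/
theorem mvfderiv_mlieBracket [I.Boundaryless] [IsManifold I 2 M] [CompleteSpace E] {f : M → F}
    (hf : ContMDiff I 𝓘(ℝ, F) 2 f) {V W : (y : M) → TangentSpace I y} {x : M}
    (hV : MDifferentiableAt I I.tangent (fun y => (⟨y, V y⟩ : TangentBundle I M)) x)
    (hW : MDifferentiableAt I I.tangent (fun y => (⟨y, W y⟩ : TangentBundle I M)) x) :
    mvfderiv I f x (mlieBracket I V W x) =
      mvfderiv I (fun y => mvfderiv I f y (W y)) x (V x)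
        - mvfderiv I (fun y => mvfderiv I f y (V y)) x (W x) := by
  have : IsManifold I 1 M := IsManifold.of_le (n := 2) one_le_two
  have htgt : (extChartAt I x).target ∈ 𝓝 (extChartAt I x x) := extChartAt_target_mem_nhds x
  have hmem : extChartAt I x x ∈ (extChartAt I x).target := mem_extChartAt_target x
  have hx : (extChartAt I x).symm (extChartAt I x x) = x := extChartAt_to_inv x
  set y₀ : E := extChartAt I x x with hy₀
  set j : E → F := f ∘ (extChartAt I x).symm with hj
  have key : ∀ (U : (y : M) → TangentSpace I y) (g : M → F), MDifferentiableAt I 𝓘(ℝ, F) g x →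
      mvfderiv I g x (U x) =
        fderiv ℝ (g ∘ (extChartAt I x).symm) y₀ (chartField I x U y₀) := by
    intro U g hg
    have h := mvfderiv_apply_extChartAt_symm hmem (f := g) (by rwa [hx]) U
    rw [← h]
    have e : ∀ z, z = x → mvfderiv I g x (U x) = mvfderiv I g z (U z) := by
      rintro z rfl; rfl
    exact e _ hx
  have hfd : MDifferentiable I 𝓘(ℝ, F) f := hf.mdifferentiable two_ne_zero
  have hj2 : ContDiffAt ℝ 2 j y₀ := by
    have := (contMDiffOn_extChartAt_symm (I := I) (n := 2) x).contMDiffAt htgt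
    exact (hf.contMDiffAt.comp y₀ this).contDiffAt
  have hjd : DifferentiableAt ℝ (fderiv ℝ j) y₀ :=
    (hj2.fderiv_right (m := 1) le_rfl).differentiableAt one_ne_zero
  -- The product rule for `V (W f)` in the chart; the second derivatives of `f` then cancel by
  -- symmetry, and the derivatives of the coordinate fields remain.
  have second : ∀ (U : (y : M) → TangentSpace I y),
      MDifferentiableAt I I.tangent (fun y => (⟨y, U y⟩ : TangentBundle I M)) x → ∀ w : E,
      fderiv ℝ ((fun y => mvfderiv I f y (U y)) ∘ (extChartAt I x).symm) y₀ w =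
        fderiv ℝ (fderiv ℝ j) y₀ w (chartField I x U y₀)
        + fderiv ℝ j y₀ (fderiv ℝ (chartField I x U) y₀ w) := by
    intro U hU w
    have he : ((fun y => mvfderiv I f y (U y)) ∘ (extChartAt I x).symm) =ᶠ[𝓝 y₀]
        fun y => fderiv ℝ j y (chartField I x U y) := by
      filter_upwards [htgt] with y hy
      exact mvfderiv_apply_extChartAt_symm hy (hfd _) U
    rw [he.fderiv_eq, fderiv_clm_apply hjd (differentiableAt_chartField hU)]
    simp [add_comm]
  have symm : ∀ a b, fderiv ℝ (fderiv ℝ j) y₀ a b = fderiv ℝ (fderiv ℝ j) y₀ b a :=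
    fun a b => (hj2.isSymmSndFDerivAt (by simp)).eq a b
  rw [key V _ (mdifferentiableAt_mvfderiv_apply hf hW),
    key W _ (mdifferentiableAt_mvfderiv_apply hf hV), second W hW, second V hV,
    mvfderiv_mlieBracket_chart (hfd x), lieBracket_eq, symm]
  simp [hj, hy₀]

end General

/-! ### Tangent vectors of an odd sphere -/

section Sphere

variable {n : ℕ}

/-- The coefficient of a vector along `i x`. -/
def xi (x : CSpace n) : CSpace n →ₗ[ℝ] ℝ where
  toFun v := (inner ℂ (Complex.I • x) v).re
  map_add' v w := by rw [inner_add_right, Complex.add_re]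
  map_smul' r v := by rw [inner_smul_right_eq_smul, Complex.smul_re]; rfl

/-- The component of a vector in the Hermitian orthogonal complement of `x`. -/
def zeta (x : CSpace n) : CSpace n →ₗ[ℝ] CSpace n where
  toFun v := v - inner ℂ x v • x
  map_add' v w := by rw [inner_add_right]; module
  map_smul' r v := by
    rw [inner_smul_right_eq_smul, smul_assoc, smul_sub]; rfl

/-- The orthogonal projection onto the tangent space of the unit sphere at `x`. -/
def tproj (x : CSpace n) : CSpace n →ₗ[ℝ] CSpace n where
  toFun v := v - (inner ℂ x v).re • x
  map_add' v w := by rw [inner_add_right, Complex.add_re]; module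
  map_smul' r v := by
    rw [inner_smul_right_eq_smul, Complex.smul_re, smul_assoc, smul_sub]; rfl

theorem re_inner_I_smul (v w : CSpace n) :
    (inner ℂ (Complex.I • v) w).re = (inner ℂ v w).im := by
  rw [inner_smul_left]; simp

theorem xi_apply (x v : CSpace n) : xi x v = (inner ℂ x v).im := re_inner_I_smul x v

theorem zeta_apply (x v : CSpace n) : zeta x v = v - inner ℂ x v • x := rfl

theorem tproj_apply (x v : CSpace n) : tproj x v = v - (inner ℂ x v).re • x := rfl

theorem inner_self_of_norm {x : CSpace n} (hx : ‖x‖ = 1) : inner ℂ x x = 1 := by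
  rw [inner_self_eq_norm_sq_to_K, hx]; simp

theorem inner_zeta {x : CSpace n} (hx : ‖x‖ = 1) (v : CSpace n) : inner ℂ x (zeta x v) = 0 := by
  rw [zeta_apply, inner_sub_right, inner_smul_right, inner_self_of_norm hx]; ring

theorem re_inner_tproj {x : CSpace n} (hx : ‖x‖ = 1) (v : CSpace n) :
    (inner ℂ x (tproj x v)).re = 0 := by
  rw [tproj_apply, inner_sub_right, inner_smul_right_eq_smul, inner_self_of_norm hx]; simp

theorem tproj_eq_self {x v : CSpace n} (hv : (inner ℂ x v).re = 0) : tproj x v = v := by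
  simp [tproj_apply, hv]

theorem xi_tproj {x : CSpace n} (hx : ‖x‖ = 1) (v : CSpace n) : xi x (tproj x v) = xi x v := by
  rw [xi_apply, xi_apply, tproj_apply, inner_sub_right, inner_smul_right_eq_smul,
    inner_self_of_norm hx]
  simp

theorem re_inner_tproj_left {x w : CSpace n} (hw : (inner ℂ x w).re = 0) (v : CSpace n) :
    (inner ℂ (tproj x v) w).re = (inner ℂ v w).re := by
  rw [tproj_apply, inner_sub_left, inner_smul_left_eq_smul, Complex.sub_re]
  simp [hw]

theorem inner_eq_xi {x v : CSpace n} (hv : (inner ℂ x v).re = 0) :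
    inner ℂ x v = Complex.I * (xi x v : ℂ) := by
  rw [xi_apply]
  apply Complex.ext <;> simp [hv]

theorem inner_eq_xi' {x v : CSpace n} (hv : (inner ℂ x v).re = 0) :
    inner ℂ v x = -(Complex.I * (xi x v : ℂ)) := by
  rw [← inner_conj_symm, inner_eq_xi hv]
  simp

/-- On tangent vectors, `Re ⟨i ζ(v), w⟩ = Re ⟨i v, w⟩`. -/
theorem re_inner_I_zeta {x v w : CSpace n} (hv : (inner ℂ x v).re = 0)
    (hw : (inner ℂ x w).re = 0) :
    (inner ℂ (Complex.I • zeta x v) w).re = (inner ℂ (Complex.I • v) w).re := by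
  rw [zeta_apply, smul_sub, inner_sub_left, smul_smul, inner_smul_left x, inner_eq_xi hv,
    inner_eq_xi hw, re_inner_I_smul]
  simp [re_inner_I_smul]

/-- The real inner product of tangent vectors in terms of their components. -/
theorem re_inner_eq {x v w : CSpace n} (hx : ‖x‖ = 1) (hv : (inner ℂ x v).re = 0)
    (hw : (inner ℂ x w).re = 0) :
    (inner ℂ v w).re = xi x v * xi x w + (inner ℂ (zeta x v) (zeta x w)).re := by
  rw [zeta_apply, zeta_apply, inner_sub_left, inner_sub_right, inner_sub_right, inner_smul_left,
    inner_smul_left, inner_smul_right, inner_smul_right, inner_self_of_norm hx, inner_eq_xi hv,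
    inner_eq_xi hw, inner_eq_xi' hv]
  simp
  ring

end Sphere

/-! ### The embedding into `ℂ^{n+1} × ℂ^{p+1}` -/

section Embedding

variable {n p : ℕ}

/-- The inclusion of `S^{2n+1} × S^{2p+1}` into `ℂ^{n+1} × ℂ^{p+1}`. -/
def incl (x : Mfd n p) : CSpace n × CSpace p := (x.1, x.2)

theorem contMDiff_incl {m : ℕ∞ω} :
    ContMDiff (ModelI n p) 𝓘(ℝ, CSpace n × CSpace p) m (incl (n := n) (p := p)) :=
  (contMDiff_coe_sphere.comp contMDiff_fst).prodMk_space (contMDiff_coe_sphere.comp contMDiff_snd)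

theorem mdifferentiable_incl :
    MDifferentiable (ModelI n p) 𝓘(ℝ, CSpace n × CSpace p) (incl (n := n) (p := p)) :=
  (contMDiff_incl (m := 1)).mdifferentiable one_ne_zero

/-- The differential of the inclusion of `S^{2n+1} × S^{2p+1}` into `ℂ^{n+1} × ℂ^{p+1}`. -/
def emb (x : Mfd n p) : Tan x →L[ℝ] CSpace n × CSpace p := mvfderiv (ModelI n p) incl x

theorem emb_fst_eq (x : Mfd n p) (u : Tan x) :
    (emb x u).1 = mvfderiv (𝓡 (2 * n + 1)) (fun y : OddSphere n => (y : CSpace n)) x.1 u.1 := by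
  have h1 : HasMFDerivAt (ModelI n p) 𝓘(ℝ, CSpace n) (fun y : Mfd n p => (y.1 : CSpace n)) x _ :=
    HasMFDerivAt.comp x ((contMDiff_coe_sphere (m := 1) (E := CSpace n)).mdifferentiable
      one_ne_zero x.1).hasMFDerivAt (hasMFDerivAt_fst (x := x))
  have h2 : HasMFDerivAt (ModelI n p) 𝓘(ℝ, CSpace n) (fun y : Mfd n p => (incl y).1) x _ :=
    HasMFDerivAt.comp x (ContinuousLinearMap.fst ℝ (CSpace n) (CSpace p)).hasMFDerivAt
      (mdifferentiable_incl x).hasMFDerivAt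
  exact congrArg (fun A : Tan x →L[ℝ] CSpace n => A u) (hasMFDerivAt_unique h2 h1)

theorem emb_snd_eq (x : Mfd n p) (u : Tan x) :
    (emb x u).2 = mvfderiv (𝓡 (2 * p + 1)) (fun y : OddSphere p => (y : CSpace p)) x.2 u.2 := by
  have h1 : HasMFDerivAt (ModelI n p) 𝓘(ℝ, CSpace p) (fun y : Mfd n p => (y.2 : CSpace p)) x _ :=
    HasMFDerivAt.comp x ((contMDiff_coe_sphere (m := 1) (E := CSpace p)).mdifferentiable
      one_ne_zero x.2).hasMFDerivAt (hasMFDerivAt_snd (x := x))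
  have h2 : HasMFDerivAt (ModelI n p) 𝓘(ℝ, CSpace p) (fun y : Mfd n p => (incl y).2) x _ :=
    HasMFDerivAt.comp x (ContinuousLinearMap.snd ℝ (CSpace n) (CSpace p)).hasMFDerivAt
      (mdifferentiable_incl x).hasMFDerivAt
  exact congrArg (fun A : Tan x →L[ℝ] CSpace p => A u) (hasMFDerivAt_unique h2 h1)

theorem emb1_eq (x : Mfd n p) (u : Tan x) : emb1 x u = (emb x u).1 := by
  have h2 : HasMFDerivAt (ModelI n p) 𝓘(ℝ, CSpace n) (fun y : Mfd n p => (incl y).1) x _ :=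
    HasMFDerivAt.comp x (ContinuousLinearMap.fst ℝ (CSpace n) (CSpace p)).hasMFDerivAt
      (mdifferentiable_incl x).hasMFDerivAt
  exact congrArg (fun A : Tan x →L[ℝ] CSpace n => A u) h2.mfderiv

theorem emb2_eq (x : Mfd n p) (u : Tan x) : emb2 x u = (emb x u).2 := by
  have h2 : HasMFDerivAt (ModelI n p) 𝓘(ℝ, CSpace p) (fun y : Mfd n p => (incl y).2) x _ :=
    HasMFDerivAt.comp x (ContinuousLinearMap.snd ℝ (CSpace n) (CSpace p)).hasMFDerivAt
      (mdifferentiable_incl x).hasMFDerivAt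
  exact congrArg (fun A : Tan x →L[ℝ] CSpace p => A u) h2.mfderiv

theorem emb_injective (x : Mfd n p) : Function.Injective (emb x) := by
  intro u v h
  have h1 := (emb_fst_eq x u).symm.trans ((congrArg Prod.fst h).trans (emb_fst_eq x v))
  have h2 := (emb_snd_eq x u).symm.trans ((congrArg Prod.snd h).trans (emb_snd_eq x v))
  exact Prod.ext (injective_mvfderiv_subtypeVal_sphere x.1 h1)
    (injective_mvfderiv_subtypeVal_sphere x.2 h2)

theorem mem_range_coe_sphere {n : ℕ} (x : OddSphere n) (v : CSpace n) :
    v ∈ (mvfderiv (𝓡 (2 * n + 1)) (fun y : OddSphere n => (y : CSpace n)) x).range ↔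
      (inner ℂ (x : CSpace n) v).re = 0 := by
  rw [range_mvfderiv_subtypeVal, Submodule.mem_orthogonal_singleton_iff_inner_right]
  simp [PiLp.inner_apply, Complex.inner]

theorem norm_fst (x : Mfd n p) : ‖(x.1 : CSpace n)‖ = 1 := norm_eq_of_mem_sphere x.1
theorem norm_snd (x : Mfd n p) : ‖(x.2 : CSpace p)‖ = 1 := norm_eq_of_mem_sphere x.2

theorem re_inner_emb_fst (x : Mfd n p) (u : Tan x) :
    (inner ℂ (x.1 : CSpace n) (emb x u).1).re = 0 := by
  rw [emb_fst_eq]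
  exact (mem_range_coe_sphere x.1 _).1 ⟨u.1, rfl⟩

theorem re_inner_emb_snd (x : Mfd n p) (u : Tan x) :
    (inner ℂ (x.2 : CSpace p) (emb x u).2).re = 0 := by
  rw [emb_snd_eq]
  exact (mem_range_coe_sphere x.2 _).1 ⟨u.2, rfl⟩

theorem exists_emb_eq (x : Mfd n p) {v : CSpace n × CSpace p}
    (h1 : (inner ℂ (x.1 : CSpace n) v.1).re = 0) (h2 : (inner ℂ (x.2 : CSpace p) v.2).re = 0) :
    ∃ u : Tan x, emb x u = v := by
  obtain ⟨u₁, hu₁⟩ := (mem_range_coe_sphere x.1 _).2 h1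
  obtain ⟨u₂, hu₂⟩ := (mem_range_coe_sphere x.2 _).2 h2
  exact ⟨(u₁, u₂), Prod.ext ((emb_fst_eq x _).trans hu₁) ((emb_snd_eq x _).trans hu₂)⟩

/-- The orthogonal projection of `ℂ^{n+1} × ℂ^{p+1}` onto the tangent space at `x`. -/
def tprojProd (x : Mfd n p) : CSpace n × CSpace p →ₗ[ℝ] CSpace n × CSpace p :=
  (tproj (x.1 : CSpace n)).prodMap (tproj (x.2 : CSpace p))

theorem tprojProd_emb (x : Mfd n p) (u : Tan x) : tprojProd x (emb x u) = emb x u :=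
  Prod.ext (tproj_eq_self (re_inner_emb_fst x u)) (tproj_eq_self (re_inner_emb_snd x u))

theorem exists_lift (x : Mfd n p) :
    ∃ L : CSpace n × CSpace p →L[ℝ] Tan x, ∀ v, emb x (L v) = tprojProd x v := by
  obtain ⟨L, hL⟩ := LinearMap.exists_leftInverse_of_injective (emb x).toLinearMap
    (LinearMap.ker_eq_bot.2 (emb_injective x))
  refine ⟨(L ∘ₗ tprojProd x).toContinuousLinearMap, fun v => ?_⟩
  obtain ⟨u, hu⟩ := exists_emb_eq x (v := tprojProd x v) (re_inner_tproj (norm_fst x) v.1)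
    (re_inner_tproj (norm_snd x) v.2)
  have h : L (emb x u) = u := LinearMap.congr_fun hL u
  change emb x (L (tprojProd x v)) = _
  rw [← hu, h]

/-- The tangential part of a vector of `ℂ^{n+1} × ℂ^{p+1}`, as a tangent vector at `x`. -/
def lift (x : Mfd n p) : CSpace n × CSpace p →L[ℝ] Tan x := (exists_lift x).choose

theorem emb_lift (x : Mfd n p) (v : CSpace n × CSpace p) : emb x (lift x v) = tprojProd x v :=
  (exists_lift x).choose_spec v

theorem lift_emb (x : Mfd n p) (u : Tan x) : lift x (emb x u) = u :=
  emb_injective x (by rw [emb_lift, tprojProd_emb])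

/-- A vector field, seen as a function with values in `ℂ^{n+1} × ℂ^{p+1}`. -/
def embField (V : (x : Mfd n p) → Tan x) (x : Mfd n p) : CSpace n × CSpace p := emb x (V x)

theorem DiffAt.embField {V : (x : Mfd n p) → Tan x} {x : Mfd n p} (hV : DiffAt V x) :
    MDifferentiableAt (ModelI n p) 𝓘(ℝ, CSpace n × CSpace p) (embField V) x :=
  mdifferentiableAt_mvfderiv_apply contMDiff_incl hV

/-- In `ℂ^{n+1} × ℂ^{p+1}` the Lie bracket is `dW(V) - dV(W)`. -/
theorem emb_mlieBracket {V W : (x : Mfd n p) → Tan x} {x : Mfd n p} (hV : DiffAt V x)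
    (hW : DiffAt W x) :
    emb x (VectorField.mlieBracket (ModelI n p) V W x) =
      mvfderiv (ModelI n p) (embField W) x (V x) - mvfderiv (ModelI n p) (embField V) x (W x) :=
  mvfderiv_mlieBracket contMDiff_incl hV hW

end Embedding

variable {n p : ℕ}

/-! ### The metric in ambient terms -/

/-- The functional `κ₁ = (1/c - 1) ξ₁ - (a/c) ξ₂`. -/
def kappa1 (a c : ℝ) (x : CSpace n × CSpace p) : CSpace n × CSpace p →ₗ[ℝ] ℝ :=
  (1 / c - 1) • (xi x.1 ∘ₗ LinearMap.fst ℝ _ _) - (a / c) • (xi x.2 ∘ₗ LinearMap.snd ℝ _ _)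

/-- The functional `κ₂ = ((a² + c²)/c - 1) ξ₂ - (a/c) ξ₁`. -/
def kappa2 (a c : ℝ) (x : CSpace n × CSpace p) : CSpace n × CSpace p →ₗ[ℝ] ℝ :=
  ((a ^ 2 + c ^ 2) / c - 1) • (xi x.2 ∘ₗ LinearMap.snd ℝ _ _)
    - (a / c) • (xi x.1 ∘ₗ LinearMap.fst ℝ _ _)

theorem kappa1_apply (a c : ℝ) (x v : CSpace n × CSpace p) :
    kappa1 a c x v = (1 / c - 1) * xi x.1 v.1 - a / c * xi x.2 v.2 := rfl

theorem kappa2_apply (a c : ℝ) (x v : CSpace n × CSpace p) :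
    kappa2 a c x v = ((a ^ 2 + c ^ 2) / c - 1) * xi x.2 v.2 - a / c * xi x.1 v.1 := rfl

/-- The form `Re ⟨v, w⟩ + ξ₁(v) κ₁(w) + ξ₂(v) κ₂(w)` on `ℂ^{n+1} × ℂ^{p+1}`, whose restriction to
tangent vectors at `x` is `g(a,c)`. It is defined for all `x`, `v`, `w`, so that it can be
differentiated in the ambient space. -/
def gform (a c : ℝ) (x v w : CSpace n × CSpace p) : ℝ :=
  (inner ℂ v.1 w.1).re + (inner ℂ v.2 w.2).re + xi x.1 v.1 * kappa1 a c x w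
    + xi x.2 v.2 * kappa2 a c x w

theorem comps_eq (x : Mfd n p) (u : Tan x) :
    comps x u = ⟨xi (x.1 : CSpace n) (emb x u).1, xi (x.2 : CSpace p) (emb x u).2,
      zeta (x.1 : CSpace n) (emb x u).1, zeta (x.2 : CSpace p) (emb x u).2⟩ := by
  rw [comps, emb1_eq, emb2_eq]; rfl

theorem metric_apply (a c : ℝ) (x : Mfd n p) (u v : Tan x) :
    metric a c x u v = 1 / c * xi (x.1 : CSpace n) (emb x u).1 * xi (x.1 : CSpace n) (emb x v).1
      - a / c * (xi (x.1 : CSpace n) (emb x u).1 * xi (x.2 : CSpace p) (emb x v).2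
        + xi (x.2 : CSpace p) (emb x u).2 * xi (x.1 : CSpace n) (emb x v).1)
      + (a ^ 2 + c ^ 2) / c * xi (x.2 : CSpace p) (emb x u).2 * xi (x.2 : CSpace p) (emb x v).2
      + (inner ℂ (zeta (x.1 : CSpace n) (emb x u).1) (zeta (x.1 : CSpace n) (emb x v).1)).re
      + (inner ℂ (zeta (x.2 : CSpace p) (emb x u).2) (zeta (x.2 : CSpace p) (emb x v).2)).re := by
  have key : ∀ {m : ℕ} (y z : CSpace m),
      (inner ℂ (Complex.I • y) (Complex.I • z)).re = (inner ℂ y z).re := by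
    intro m y z
    rw [re_inner_I_smul, inner_smul_right]
    simp
  rw [metric, comps_eq, comps_eq, omega, cstr]
  simp only [key]
  ring

theorem metric_eq (a c : ℝ) (x : Mfd n p) (u v : Tan x) :
    metric a c x u v = gform a c (incl x) (emb x u) (emb x v) := by
  rw [metric_apply, gform, re_inner_eq (norm_fst x) (re_inner_emb_fst x u) (re_inner_emb_fst x v),
    re_inner_eq (norm_snd x) (re_inner_emb_snd x u) (re_inner_emb_snd x v), kappa1_apply,
    kappa2_apply]
  simp only [incl]
  ring

theorem metric_symm (a c : ℝ) (x : Mfd n p) (u v : Tan x) :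
    metric a c x u v = metric a c x v u := by
  rw [metric_eq, metric_eq, gform, gform, kappa1_apply, kappa2_apply, kappa1_apply, kappa2_apply,
    ← inner_conj_symm (emb x u).1, ← inner_conj_symm (emb x u).2, Complex.conj_re, Complex.conj_re]
  ring

theorem metric_sub_left (a c : ℝ) (x : Mfd n p) (u u' v : Tan x) :
    metric a c x (u - u') v = metric a c x u v - metric a c x u' v := by
  simp only [metric_eq, gform, map_sub, Prod.fst_sub, Prod.snd_sub, inner_sub_left,
    Complex.sub_re]
  ring

theorem metric_sub_right (a c : ℝ) (x : Mfd n p) (u v v' : Tan x) :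
    metric a c x u (v - v') = metric a c x u v - metric a c x u v' := by
  rw [metric_symm, metric_sub_left, metric_symm, metric_symm a c x v']

theorem eq_zero_of_metric_self {a c : ℝ} (hc : 0 < c) {x : Mfd n p} {u : Tan x}
    (h : metric a c x u u = 0) : u = 0 := by
  rw [metric_apply] at h
  set s := xi (x.1 : CSpace n) (emb x u).1 with hs
  set t := xi (x.2 : CSpace p) (emb x u).2 with ht
  have e : ∀ {m : ℕ} (z : CSpace m), (inner ℂ z z).re = ‖z‖ ^ 2 := fun z =>
    inner_self_eq_norm_sq (𝕜 := ℂ) z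
  -- Completing the square shows that the form in `ξ₁, ξ₂` is positive definite.
  have hsq : 1 / c * s * s - a / c * (s * t + t * s) + (a ^ 2 + c ^ 2) / c * t * t
      = 1 / c * (s - a * t) ^ 2 + c * t ^ 2 := by
    field_simp; ring
  rw [hsq, e, e] at h
  have h1 : 0 ≤ 1 / c * (s - a * t) ^ 2 := by positivity
  have h2 : 0 ≤ c * t ^ 2 := by positivity
  have h3 := sq_nonneg ‖zeta (x.1 : CSpace n) (emb x u).1‖
  have h4 := sq_nonneg ‖zeta (x.2 : CSpace p) (emb x u).2‖
  have t0 : t = 0 := by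
    have : c * t ^ 2 = 0 := by linarith
    simpa [hc.ne'] using this
  have s0 : s = 0 := by
    have : 1 / c * (s - a * t) ^ 2 = 0 := by linarith
    simpa [hc.ne', t0] using this
  have z1 : zeta (x.1 : CSpace n) (emb x u).1 = 0 := by
    have : ‖zeta (x.1 : CSpace n) (emb x u).1‖ ^ 2 = 0 := by linarith
    simpa using this
  have z2 : zeta (x.2 : CSpace p) (emb x u).2 = 0 := by
    have : ‖zeta (x.2 : CSpace p) (emb x u).2‖ ^ 2 = 0 := by linarith
    simpa using this
  rw [zeta_apply, inner_eq_xi (re_inner_emb_fst x u), ← hs, s0] at z1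
  rw [zeta_apply, inner_eq_xi (re_inner_emb_snd x u), ← ht, t0] at z2
  apply emb_injective x
  rw [map_zero]
  exact Prod.ext (by simpa using z1) (by simpa using z2)

/-! ### The connection -/

/-- The difference between the Levi-Civita connection of `g(a,c)` and that of the round metric:
`Γ(v, u)_j = i (κ_j(u) ζ_j(v) + κ_j(v) ζ_j(u))`. -/
def christoffel (a c : ℝ) (x : CSpace n × CSpace p) :
    CSpace n × CSpace p →ₗ[ℝ] CSpace n × CSpace p →ₗ[ℝ] CSpace n × CSpace p :=
  LinearMap.mk₂ ℝ (fun v u =>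
    (Complex.I • (kappa1 a c x u • zeta x.1 v.1 + kappa1 a c x v • zeta x.1 u.1),
      Complex.I • (kappa2 a c x u • zeta x.2 v.2 + kappa2 a c x v • zeta x.2 u.2)))
    (fun v v' u => by
      simp only [map_add, Prod.fst_add, Prod.snd_add, Prod.mk_add_mk]
      congr 1 <;> module)
    (fun r v u => by
      simp only [map_smul, Prod.smul_fst, Prod.smul_snd, Prod.smul_mk, smul_eq_mul]
      congr 1 <;> (rw [smul_comm r]; congr 1; module))
    (fun v u u' => by
      simp only [map_add, Prod.fst_add, Prod.snd_add, Prod.mk_add_mk]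
      congr 1 <;> module)
    (fun r v u => by
      simp only [map_smul, Prod.smul_fst, Prod.smul_snd, Prod.smul_mk, smul_eq_mul]
      congr 1 <;> (rw [smul_comm r]; congr 1; module))

theorem christoffel_apply (a c : ℝ) (x v u : CSpace n × CSpace p) : christoffel a c x v u =
    (Complex.I • (kappa1 a c x u • zeta x.1 v.1 + kappa1 a c x v • zeta x.1 u.1),
      Complex.I • (kappa2 a c x u • zeta x.2 v.2 + kappa2 a c x v • zeta x.2 u.2)) := rfl

theorem christoffel_symm (a c : ℝ) (x v u : CSpace n × CSpace p) :
    christoffel a c x v u = christoffel a c x u v := by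
  rw [christoffel_apply, christoffel_apply]
  congr 2 <;> abel

theorem embField_add (V W : (x : Mfd n p) → Tan x) :
    embField (V + W) = embField V + embField W := funext fun x => map_add (emb x) _ _

theorem embField_smul (f : Mfd n p → ℝ) (V : (x : Mfd n p) → Tan x) :
    embField (f • V) = f • embField V := funext fun x => map_smul (emb x) _ _

/-- The connection for which `∇_u V` is the tangential part of `dV(u) + Γ(V, u)`. -/
def connection (a c : ℝ) : Connection n p where
  toFun V x := lift x ∘L (mvfderiv (ModelI n p) (embField V) x
    + (christoffel a c (incl x) (embField V x)).toContinuousLinearMap ∘L emb x)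
  isCovariantDerivativeOnUniv :=
    { add := by
        intro V W x hV hW _
        rw [embField_add, mvfderiv_add (DiffAt.embField hV) (DiffAt.embField hW)]
        ext1 u
        simp
        abel
      leibniz := by
        intro V g x hV hg _
        rw [embField_smul, mvfderiv_smul hg (DiffAt.embField hV)]
        ext1 u
        have : lift x (embField V x) = V x := lift_emb x _
        simp [this]
        abel }

theorem emb_connection (a c : ℝ) (V : (x : Mfd n p) → Tan x) (x : Mfd n p) (u : Tan x) :
    emb x (connection a c V x u) = tprojProd x (mvfderiv (ModelI n p) (embField V) x u
      + christoffel a c (incl x) (embField V x) (emb x u)) := emb_lift x _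

/-! ### The connection is torsion-free and metric -/

theorem torsion_connection (a c : ℝ) : (connection (n := n) (p := p) a c).torsion = 0 := by
  rw [CovariantDerivative.torsion_eq_zero_iff]
  intro V W x hV hW
  apply emb_injective x
  have h := tprojProd_emb x (VectorField.mlieBracket (ModelI n p) V W x)
  rw [map_sub, emb_connection, emb_connection, ← h, emb_mlieBracket hV hW, ← map_sub]
  congr 1
  have hs := christoffel_symm a c (incl x) (embField W x) (emb x (V x))
  rw [hs]
  exact add_sub_add_right_eq_sub _ _ _

theorem hasDerivAt_re_inner {m : ℕ} {f g : ℝ → CSpace m} {f' g' : CSpace m} {t : ℝ}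
    (hf : HasDerivAt f f' t) (hg : HasDerivAt g g' t) :
    HasDerivAt (fun s => (inner ℂ (f s) (g s)).re)
      ((inner ℂ f' (g t)).re + (inner ℂ (f t) g').re) t := by
  refine (Complex.reCLM.hasFDerivAt.comp_hasDerivAt t (hf.inner ℂ hg)).congr_deriv ?_
  simp [add_comm]

theorem hasDerivAt_im_inner {m : ℕ} {f g : ℝ → CSpace m} {f' g' : CSpace m} {t : ℝ}
    (hf : HasDerivAt f f' t) (hg : HasDerivAt g g' t) :
    HasDerivAt (fun s => (inner ℂ (f s) (g s)).im)
      ((inner ℂ f' (g t)).im + (inner ℂ (f t) g').im) t := by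
  refine (Complex.imCLM.hasFDerivAt.comp_hasDerivAt t (hf.inner ℂ hg)).congr_deriv ?_
  simp [add_comm]

theorem gform_apply (a c : ℝ) (x v w : CSpace n × CSpace p) :
    gform a c x v w = (inner ℂ v.1 w.1).re + (inner ℂ v.2 w.2).re
      + (inner ℂ x.1 v.1).im * ((1 / c - 1) * (inner ℂ x.1 w.1).im - a / c * (inner ℂ x.2 w.2).im)
      + (inner ℂ x.2 v.2).im * (((a ^ 2 + c ^ 2) / c - 1) * (inner ℂ x.2 w.2).im
        - a / c * (inner ℂ x.1 w.1).im) := by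
  simp only [gform, kappa1_apply, kappa2_apply, xi_apply]

theorem differentiable_gform (a c : ℝ) : Differentiable ℝ
    (fun q : (CSpace n × CSpace p) × (CSpace n × CSpace p) × (CSpace n × CSpace p) =>
      gform a c q.1 q.2.1 q.2.2) := by
  have hi : ∀ {m : ℕ} {f g : (CSpace n × CSpace p) × (CSpace n × CSpace p) × (CSpace n × CSpace p)
      → CSpace m}, Differentiable ℝ f → Differentiable ℝ g →
      Differentiable ℝ (fun q => inner ℂ (f q) (g q)) := fun hf hg => hf.inner ℂ hg
  have hre : ∀ {m : ℕ} {f g : (CSpace n × CSpace p) × (CSpace n × CSpace p) × (CSpace n × CSpace p)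
      → CSpace m}, Differentiable ℝ f → Differentiable ℝ g →
      Differentiable ℝ (fun q => (inner ℂ (f q) (g q)).re) := fun hf hg =>
    Complex.reCLM.differentiable.comp (hi hf hg)
  have him : ∀ {m : ℕ} {f g : (CSpace n × CSpace p) × (CSpace n × CSpace p) × (CSpace n × CSpace p)
      → CSpace m}, Differentiable ℝ f → Differentiable ℝ g →
      Differentiable ℝ (fun q => (inner ℂ (f q) (g q)).im) := fun hf hg =>
    Complex.imCLM.differentiable.comp (hi hf hg)
  have x1 : Differentiable ℝ (fun q : (CSpace n × CSpace p) × (CSpace n × CSpace p) ×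
    (CSpace n × CSpace p) => q.1.1) := by fun_prop
  have x2 : Differentiable ℝ (fun q : (CSpace n × CSpace p) × (CSpace n × CSpace p) ×
    (CSpace n × CSpace p) => q.1.2) := by fun_prop
  have v1 : Differentiable ℝ (fun q : (CSpace n × CSpace p) × (CSpace n × CSpace p) ×
    (CSpace n × CSpace p) => q.2.1.1) := by fun_prop
  have v2 : Differentiable ℝ (fun q : (CSpace n × CSpace p) × (CSpace n × CSpace p) ×
    (CSpace n × CSpace p) => q.2.1.2) := by fun_prop
  have w1 : Differentiable ℝ (fun q : (CSpace n × CSpace p) × (CSpace n × CSpace p) ×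
    (CSpace n × CSpace p) => q.2.2.1) := by fun_prop
  have w2 : Differentiable ℝ (fun q : (CSpace n × CSpace p) × (CSpace n × CSpace p) ×
    (CSpace n × CSpace p) => q.2.2.2) := by fun_prop
  simp only [gform_apply]
  exact (((hre v1 w1).add (hre v2 w2)).add ((him x1 v1).mul
    (((him x1 w1).const_mul _).sub ((him x2 w2).const_mul _)))).add ((him x2 v2).mul
    (((him x2 w2).const_mul _).sub ((him x1 w1).const_mul _)))

theorem hasDerivAt_gform (a c : ℝ) {x v w : ℝ → CSpace n × CSpace p}
    {x' v' w' : CSpace n × CSpace p} {t : ℝ}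
    (hx : HasDerivAt x x' t) (hv : HasDerivAt v v' t) (hw : HasDerivAt w w' t) :
    HasDerivAt (fun s => gform a c (x s) (v s) (w s))
      (gform a c (x t) v' (w t) + gform a c (x t) (v t) w'
        + (inner ℂ x'.1 (v t).1).im * kappa1 a c (x t) (w t)
        + (inner ℂ x'.2 (v t).2).im * kappa2 a c (x t) (w t)
        + (inner ℂ x'.1 (w t).1).im * kappa1 a c (x t) (v t)
        + (inner ℂ x'.2 (w t).2).im * kappa2 a c (x t) (v t)) t := by
  have fst : ∀ {y : ℝ → CSpace n × CSpace p} {y' : CSpace n × CSpace p}, HasDerivAt y y' t →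
      HasDerivAt (fun s => (y s).1) y'.1 t := fun h =>
    (ContinuousLinearMap.fst ℝ (CSpace n) (CSpace p)).hasFDerivAt.comp_hasDerivAt t h
  have snd : ∀ {y : ℝ → CSpace n × CSpace p} {y' : CSpace n × CSpace p}, HasDerivAt y y' t →
      HasDerivAt (fun s => (y s).2) y'.2 t := fun h =>
    (ContinuousLinearMap.snd ℝ (CSpace n) (CSpace p)).hasFDerivAt.comp_hasDerivAt t h
  have xv1 := hasDerivAt_im_inner (fst hx) (fst hv)
  have xv2 := hasDerivAt_im_inner (snd hx) (snd hv)
  have xw1 := hasDerivAt_im_inner (fst hx) (fst hw)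
  have xw2 := hasDerivAt_im_inner (snd hx) (snd hw)
  simp only [gform_apply, kappa1_apply, kappa2_apply, xi_apply]
  refine ((((hasDerivAt_re_inner (fst hv) (fst hw)).add
    (hasDerivAt_re_inner (snd hv) (snd hw))).add (xv1.mul
    ((xw1.const_mul (1 / c - 1)).sub (xw2.const_mul (a / c))))).add (xv2.mul
    ((xw2.const_mul ((a ^ 2 + c ^ 2) / c - 1)).sub (xw1.const_mul (a / c))))).congr_deriv ?_
  simp only [Pi.sub_apply]
  ring

/-- Pairing with a tangent vector sees only the tangential part. -/
theorem gform_tprojProd (a c : ℝ) (x : Mfd n p) (v : CSpace n × CSpace p) (w : Tan x) :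
    gform a c (incl x) (tprojProd x v) (emb x w) = gform a c (incl x) v (emb x w) := by
  have h1 : (tprojProd x v).1 = tproj (x.1 : CSpace n) v.1 := rfl
  have h2 : (tprojProd x v).2 = tproj (x.2 : CSpace p) v.2 := rfl
  rw [gform, gform, h1, h2, re_inner_tproj_left (re_inner_emb_fst x w),
    re_inner_tproj_left (re_inner_emb_snd x w)]
  simp only [incl, xi_tproj (norm_fst x), xi_tproj (norm_snd x)]

theorem gform_symm (a c : ℝ) (x v w : CSpace n × CSpace p) :
    gform a c x v w = gform a c x w v := by
  rw [gform_apply, gform_apply, ← inner_conj_symm v.1 w.1, ← inner_conj_symm v.2 w.2,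
    Complex.conj_re, Complex.conj_re]
  ring

theorem gform_add_left (a c : ℝ) (x v v' w : CSpace n × CSpace p) :
    gform a c x (v + v') w = gform a c x v w + gform a c x v' w := by
  simp only [gform, map_add, Prod.fst_add, Prod.snd_add, inner_add_left, Complex.add_re]
  ring

theorem xi_I_smul_zeta {m : ℕ} {x : CSpace m} (hx : ‖x‖ = 1) (v : CSpace m) :
    xi x (Complex.I • zeta x v) = 0 := by
  rw [xi_apply, inner_smul_right, inner_zeta hx]; simp

theorem gform_christoffel (a c : ℝ) (x : Mfd n p) (u v w : Tan x) :
    gform a c (incl x) (christoffel a c (incl x) (emb x v) (emb x u)) (emb x w) =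
      kappa1 a c (incl x) (emb x u) * (inner ℂ (emb x v).1 (emb x w).1).im
      + kappa1 a c (incl x) (emb x v) * (inner ℂ (emb x u).1 (emb x w).1).im
      + kappa2 a c (incl x) (emb x u) * (inner ℂ (emb x v).2 (emb x w).2).im
      + kappa2 a c (incl x) (emb x v) * (inner ℂ (emb x u).2 (emb x w).2).im := by
  rw [gform, christoffel_apply]
  have n1 := norm_fst x
  have n2 := norm_snd x
  have e : ∀ {m : ℕ} (r : ℝ) (y : CSpace m), Complex.I • r • y = r • (Complex.I • y) :=
    fun r y => smul_comm _ _ _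
  simp only [smul_add, e, map_add, map_smul, incl, xi_I_smul_zeta n1, xi_I_smul_zeta n2,
    inner_add_left, inner_smul_left_eq_smul, Complex.add_re, Complex.smul_re,
    re_inner_I_zeta (re_inner_emb_fst x _) (re_inner_emb_fst x _),
    re_inner_I_zeta (re_inner_emb_snd x _) (re_inner_emb_snd x _), re_inner_I_smul, smul_eq_mul]
  ring

theorem im_inner_swap {m : ℕ} (v w : CSpace m) : (inner ℂ v w).im = -(inner ℂ w v).im := by
  rw [← inner_conj_symm, Complex.conj_im]

/-- Algebraic form of the compatibility of the connection with the metric. -/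
theorem gform_covariant (a c : ℝ) (x : Mfd n p) (u v w : Tan x) (v' w' : CSpace n × CSpace p) :
    gform a c (incl x) (tprojProd x (v' + christoffel a c (incl x) (emb x v) (emb x u))) (emb x w)
      + gform a c (incl x) (emb x v)
        (tprojProd x (w' + christoffel a c (incl x) (emb x w) (emb x u)))
      = gform a c (incl x) v' (emb x w) + gform a c (incl x) (emb x v) w'
        + (inner ℂ (emb x u).1 (emb x v).1).im * kappa1 a c (incl x) (emb x w)
        + (inner ℂ (emb x u).2 (emb x v).2).im * kappa2 a c (incl x) (emb x w)
        + (inner ℂ (emb x u).1 (emb x w).1).im * kappa1 a c (incl x) (emb x v)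
        + (inner ℂ (emb x u).2 (emb x w).2).im * kappa2 a c (incl x) (emb x v) := by
  rw [gform_symm a c (incl x) (emb x v), gform_symm a c (incl x) (emb x v), gform_tprojProd,
    gform_tprojProd, gform_add_left, gform_add_left, gform_christoffel, gform_christoffel,
    im_inner_swap (emb x v).1 (emb x w).1, im_inner_swap (emb x v).2 (emb x w).2]
  ring

theorem mvfderiv_metric (a c : ℝ) {x : Mfd n p} {V W : (y : Mfd n p) → Tan y}
    (hV : DiffAt V x) (hW : DiffAt W x) (u : Tan x) :
    mvfderiv (ModelI n p) (fun y => metric a c y (V y) (W y)) x u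
      = metric a c x (connection a c V x u) (W x) + metric a c x (V x) (connection a c W x u) := by
  have hfun : (fun y => metric a c y (V y) (W y)) =
      fun y => gform a c (incl y) (embField V y) (embField W y) :=
    funext fun y => metric_eq a c y _ _
  have hmd : MDifferentiableAt (ModelI n p) 𝓘(ℝ, ℝ)
      (fun y => gform a c (incl y) (embField V y) (embField W y)) x := by
    have h := (mdifferentiable_incl x).prodMk_space (hV.embField.prodMk_space hW.embField)
    have h0 := (differentiable_gform a c) (incl x, embField V x, embField W x)
    exact h0.mdifferentiableAt.comp x h
  -- Both sides are derivatives along a curve through `x` with velocity `u`.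
  have h1 := hasDerivAt_comp_chartLine hmd u
  have h2 := hasDerivAt_gform a c (hasDerivAt_comp_chartLine (mdifferentiable_incl x) u)
    (hasDerivAt_comp_chartLine hV.embField u) (hasDerivAt_comp_chartLine hW.embField u)
  have h3 := h1.unique h2
  rw [chartLine_zero] at h3
  rw [hfun, metric_eq, metric_eq, emb_connection, emb_connection]
  exact h3.trans (gform_covariant a c x u (V x) (W x) _ _).symm

theorem isRiemannianConnection_connection (a c : ℝ) :
    IsRiemannianConnection (metric (n := n) (p := p) a c) (connection a c) where
  torsion_free := torsion_connection a c
  metric_compatible _ _ _ hV hW u := mvfderiv_metric a c hV hW u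

/-! ### Uniqueness of the Levi-Civita connection -/

/-- Two Riemannian connections of `g(a,c)` agree on every field at every point where the field is
differentiable. At other points a covariant derivative is not determined. -/
theorem IsRiemannianConnection.apply_eq {a c : ℝ} (hc : 0 < c) {D D' : Connection n p}
    (hD : IsRiemannianConnection (metric a c) D) (hD' : IsRiemannianConnection (metric a c) D')
    {V : (x : Mfd n p) → Tan x} {x : Mfd n p} (hV : DiffAt V x) : D V x = D' V x := by
  set S := IsCovariantDerivativeOn.difference D.isCovariantDerivativeOnUniv
    D'.isCovariantDerivativeOnUniv x with hS
  have hS' : ∀ {W : (x : Mfd n p) → Tan x}, DiffAt W x → S (W x) = D W x - D' W x := by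
    intro W hW
    exact IsCovariantDerivativeOn.difference_apply D.isCovariantDerivativeOnUniv
      D'.isCovariantDerivativeOnUniv (Set.mem_univ x) hW
  have ext : ∀ v : Tan x, ∃ W : (x : Mfd n p) → Tan x, DiffAt W x ∧ W x = v := fun v =>
    ⟨FiberBundle.extend (ModelE n p) v, FiberBundle.mdifferentiableAt_extend _ _ v, by simp⟩
  have symm : ∀ v u : Tan x, S v u = S u v := by
    intro v u
    obtain ⟨W, hW, rfl⟩ := ext v
    obtain ⟨Z, hZ, rfl⟩ := ext u
    have h1 := D.torsion_eq_zero_iff.1 hD.torsion_free hZ hW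
    have h2 := D'.torsion_eq_zero_iff.1 hD'.torsion_free hZ hW
    rw [hS' hW, hS' hZ]
    have h3 := h1.trans h2.symm
    change D W x (Z x) - D' W x (Z x) = D Z x (W x) - D' Z x (W x)
    rw [sub_eq_sub_iff_sub_eq_sub]
    exact h3
  have skew : ∀ v u w : Tan x, metric a c x (S v u) w = -metric a c x (S w u) v := by
    intro v u w
    obtain ⟨W, hW, rfl⟩ := ext v
    obtain ⟨Z, hZ, rfl⟩ := ext w
    have h1 := hD.metric_compatible x W Z hW hZ u
    have h2 := hD'.metric_compatible x W Z hW hZ u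
    rw [hS' hW, hS' hZ]
    have e1 := metric_sub_left a c x (D W x u) (D' W x u) (Z x)
    have e2 := metric_sub_right a c x (W x) (D Z x u) (D' Z x u)
    have alg : ∀ d q r s t : ℝ, d = q + r → d = s + t → q - s = -(r - t) := by
      intros; linarith
    exact e1.trans ((alg _ _ _ _ _ h1 h2).trans
      (congrArg Neg.neg (e2.symm.trans (metric_symm a c x _ _))))
  -- A trilinear form that is symmetric in one pair of arguments and skew in another pair is zero.
  have zero : ∀ v u : Tan x, S v u = 0 := by
    intro v u
    apply eq_zero_of_metric_self hc
    have h : ∀ w, metric a c x (S v u) w = 0 := by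
      intro w
      have h1 := skew u v w
      have h2 := skew v w u
      have h3 := skew w u v
      rw [symm u v] at h1
      rw [symm w v] at h1
      rw [symm u w] at h2
      linarith
    exact h _
  have h := hS' hV
  ext1 u
  have h1 := zero (V x) u
  rw [h] at h1
  exact sub_eq_zero.1 h1

/-! ### Fundamental vector fields -/

section Flow

-- The exponential series needs a norm on matrices; which one does not matter.
open scoped Matrix.Norms.Operator

/-- A complex matrix as a real-linear operator on `ℂ^{n+1}`. -/
def matOp {n : ℕ} : Matrix (Fin (n + 1)) (Fin (n + 1)) ℂ →ₗ[ℝ] CSpace n →L[ℝ] CSpace n where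
  toFun B := (toEuclideanCLM (n := Fin (n + 1)) (𝕜 := ℂ) B).restrictScalars ℝ
  map_add' B C := by ext1 v; simp
  map_smul' r B := by
    ext1 v
    change WithLp.toLp 2 ((r • B) *ᵥ v.ofLp) = r • (WithLp.toLp 2 (B *ᵥ v.ofLp) : CSpace n)
    rw [smul_mulVec]
    rfl

theorem matOp_apply {n : ℕ} (B : Matrix (Fin (n + 1)) (Fin (n + 1)) ℂ) (v : CSpace n) :
    matOp B v = WithLp.toLp 2 (B *ᵥ v.ofLp) := rfl

theorem contDiff_matOp_exp {n : ℕ} {m : ℕ∞ω}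
    (A : Matrix (Fin (n + 1)) (Fin (n + 1)) ℂ) :
    ContDiff ℝ m fun q : ℝ × CSpace n => matOp (NormedSpace.exp (q.1 • A)) q.2 := by
  have h : ContDiff ℝ m (NormedSpace.exp : Matrix (Fin (n + 1)) (Fin (n + 1)) ℂ → _) :=
    contDiff_iff_contDiffAt.2 fun x => (NormedSpace.exp_analytic (𝕂 := ℝ) x).contDiffAt
  have h2 : ContDiff ℝ m (matOp (n := n)) := matOp.toContinuousLinearMap.contDiff
  exact (h2.comp (h.comp (contDiff_fst.smul contDiff_const))).clm_apply contDiff_snd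

theorem hasDerivAt_matOp_exp {n : ℕ} (A : Matrix (Fin (n + 1)) (Fin (n + 1)) ℂ) (v : CSpace n) :
    HasDerivAt (fun t : ℝ => matOp (NormedSpace.exp (t • A)) v) (matOp A v) 0 := by
  have h := hasDerivAt_exp_smul_const (𝕂 := ℝ) A (0 : ℝ)
  rw [zero_smul, NormedSpace.exp_zero, one_mul] at h
  have h2 := (matOp (n := n)).toContinuousLinearMap.hasFDerivAt.comp_hasDerivAt (0 : ℝ) h
  exact h2.clm_apply (hasDerivAt_const (0 : ℝ) v) |>.congr_deriv (by simp; rfl)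

end Flow

theorem contMDiff_rotate_expU {m : ℕ∞ω} (A : uLie n) :
    ContMDiff (𝓘(ℝ, ℝ).prod (𝓡 (2 * n + 1))) (𝓡 (2 * n + 1)) m
      fun q : ℝ × OddSphere n => rotate (expU A q.1) q.2 := by
  have h0 : ContMDiff (𝓘(ℝ, ℝ).prod (𝓡 (2 * n + 1))) 𝓘(ℝ, CSpace n) m
      fun q : ℝ × OddSphere n => (q.2 : CSpace n) := contMDiff_coe_sphere.comp contMDiff_snd
  have h1 : ContMDiff (𝓘(ℝ, ℝ).prod (𝓡 (2 * n + 1))) 𝓘(ℝ, ℝ) m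
      fun q : ℝ × OddSphere n => q.1 := contMDiff_fst
  have h := (contDiff_matOp_exp (m := m) A.1).contMDiff.comp (h1.prodMk_space h0)
  have h2 := h.codRestrict_sphere (n := 2 * n + 1) fun q => (rotate (expU A q.1) q.2).2
  exact h2

/-- The action of the one-parameter group generated by `A`. -/
def flow (A : gLie n p) (q : ℝ × Mfd n p) : Mfd n p := act (expU A.1 q.1, expU A.2 q.1) q.2

theorem contMDiff_flow {m : ℕ∞ω} (A : gLie n p) :
    ContMDiff (𝓘(ℝ, ℝ).prod (ModelI n p)) (ModelI n p) m (flow A) := by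
  have t : ContMDiff (𝓘(ℝ, ℝ).prod (ModelI n p)) 𝓘(ℝ, ℝ) m fun q : ℝ × Mfd n p => q.1 :=
    contMDiff_fst
  have x : ContMDiff (𝓘(ℝ, ℝ).prod (ModelI n p)) (ModelI n p) m fun q : ℝ × Mfd n p => q.2 :=
    contMDiff_snd
  have x1 : ContMDiff (𝓘(ℝ, ℝ).prod (ModelI n p)) (𝓡 (2 * n + 1)) m
      fun q : ℝ × Mfd n p => q.2.1 := contMDiff_fst.comp x
  have x2 : ContMDiff (𝓘(ℝ, ℝ).prod (ModelI n p)) (𝓡 (2 * p + 1)) m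
      fun q : ℝ × Mfd n p => q.2.2 := contMDiff_snd.comp x
  have h1 := (contMDiff_rotate_expU (m := m) A.1).comp (t.prodMk x1)
  have h2 := (contMDiff_rotate_expU (m := m) A.2).comp (t.prodMk x2)
  exact h1.prodMk h2

theorem incl_flow (A : gLie n p) (t : ℝ) (x : Mfd n p) : incl (flow A (t, x)) =
    (matOp (NormedSpace.exp (t • A.1.1)) (x.1 : CSpace n),
      matOp (NormedSpace.exp (t • A.2.1)) (x.2 : CSpace p)) := rfl

theorem flow_zero (A : gLie n p) (x : Mfd n p) : flow A (0, x) = x := by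
  have h : incl (flow A (0, x)) = incl x := by
    rw [incl_flow]
    simp [matOp_apply, incl]
  exact Prod.ext (Subtype.ext (congrArg Prod.fst h)) (Subtype.ext (congrArg Prod.snd h))

theorem mdifferentiable_flow (A : gLie n p) :
    MDifferentiable (𝓘(ℝ, ℝ).prod (ModelI n p)) (ModelI n p) (flow A) :=
  (contMDiff_flow (m := 1) A).mdifferentiable one_ne_zero

theorem hasMFDerivAt_prodMk_const (x : Mfd n p) :
    HasMFDerivAt 𝓘(ℝ, ℝ) (𝓘(ℝ, ℝ).prod (ModelI n p)) (fun t : ℝ => (t, x)) 0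
      ((ContinuousLinearMap.id ℝ (TangentSpace 𝓘(ℝ, ℝ) (0 : ℝ))).prod
        (0 : TangentSpace 𝓘(ℝ, ℝ) (0 : ℝ) →L[ℝ] Tan x)) :=
  (hasMFDerivAt_id _).prodMk (hasMFDerivAt_const _ _)

theorem mdifferentiableAt_flow_curve (A : gLie n p) (x : Mfd n p) :
    MDifferentiableAt 𝓘(ℝ, ℝ) (ModelI n p) (fun t : ℝ => flow A (t, x)) 0 :=
  (mdifferentiable_flow A _).comp (0 : ℝ) (hasMFDerivAt_prodMk_const x).mdifferentiableAt

/-- The fundamental field of `A` is the restriction of the linear vector field `y ↦ A y`. -/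
theorem emb_fund (A : gLie n p) (x : Mfd n p) :
    emb x (fund A x) = (matOp A.1.1 (x.1 : CSpace n), matOp A.2.1 (x.2 : CSpace p)) := by
  have key : ∀ (y : Mfd n p) (w : ModelE n p), y = x →
      emb x (w : Tan x) = emb y (w : Tan y) := by
    rintro y w rfl; rfl
  -- The chain rule takes place at `flow A (0, x)`, equal to `x` only propositionally.
  rw [key (flow A (0, x)) (fund A x) (flow_zero A x)]
  have h1 := (mdifferentiable_incl (flow A (0, x))).hasMFDerivAt.comp (0 : ℝ)
    (mdifferentiableAt_flow_curve A x).hasMFDerivAt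
  have h2 : HasDerivAt (fun t : ℝ => (matOp (NormedSpace.exp (t • A.1.1)) (x.1 : CSpace n),
      matOp (NormedSpace.exp (t • A.2.1)) (x.2 : CSpace p))) _ 0 :=
    (hasDerivAt_matOp_exp A.1.1 (x.1 : CSpace n)).prodMk
      (hasDerivAt_matOp_exp A.2.1 (x.2 : CSpace p))
  exact congrArg (fun B : ℝ →L[ℝ] CSpace n × CSpace p => B 1)
    ((hasMFDerivAt_unique h1 h2.hasFDerivAt.hasMFDerivAt)) |>.trans (one_smul ℝ _)

/-- The field `A*` is differentiable, being the derivative of the smooth map `flow A` in the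
`t`-direction at `t = 0`. -/
theorem diffAt_fund (A : gLie n p) (x : Mfd n p) : DiffAt (fund A) x := by
  have h1 : ContMDiff (ModelI n p) (𝓘(ℝ, ℝ).tangent.prod (ModelI n p).tangent) 1
      (fun y : Mfd n p => ((⟨0, (1 : ℝ)⟩ : TangentBundle 𝓘(ℝ, ℝ) ℝ),
        (⟨y, 0⟩ : TangentBundle (ModelI n p) (Mfd n p)))) :=
    contMDiff_const.prodMk (Bundle.contMDiff_zeroSection ℝ (TangentSpace (ModelI n p)))
  have h2 := ((contMDiff_flow (m := 2) A).contMDiff_tangentMap (m := 1) le_rfl).comp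
    (contMDiff_equivTangentBundleProd_symm.comp h1)
  refine (h2.mdifferentiable one_ne_zero x).congr_of_eventuallyEq
    (Filter.Eventually.of_forall fun y => ?_)
  have key : ∀ (z : Mfd n p) (w w' : ModelE n p), z = y → w = w' →
      (⟨y, w⟩ : TangentBundle (ModelI n p) (Mfd n p)) = ⟨z, w'⟩ := by
    rintro z w w' rfl rfl; rfl
  refine key (flow A (0, y)) (fund A y) _ (flow_zero A y) ?_
  have h3 := ((mdifferentiable_flow A (0, y)).hasMFDerivAt.comp (0 : ℝ)
    (hasMFDerivAt_prodMk_const y)).mfderiv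
  exact congrArg (fun B : ℝ →L[ℝ] ModelE n p => B 1) h3

/-! ### The map `U` -/

/-- The coordinate of the `𝔭`-component of `A ∈ 𝔲(n+1)` along `X`. -/
def uXi (n : ℕ) : uLie n →ₗ[ℝ] ℝ where
  toFun A := (A.1 0 0).im
  map_add' A B := by simp
  map_smul' r A := by simp

/-- The map `A ↦ [A, X]_𝔭`, which is `0` on `X` and rotates `Y_{2ν-1} ↦ Y_{2ν} ↦ -Y_{2ν-1}`. -/
def uJ (n : ℕ) : uLie n →ₗ[ℝ] uLie n where
  toFun A := uProj (uBracket A (uX n))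
  map_add' A B := by
    ext i j
    simp only [uProj, uBracket, Submodule.coe_add, Matrix.of_apply, Matrix.add_apply]
    split_ifs
    · simp [add_mul, mul_add]; ring
    · simp
  map_smul' r A := by
    ext i j
    simp only [uProj, uBracket, Submodule.coe_smul, Matrix.of_apply, Matrix.smul_apply,
      RingHom.id_apply]
    split_ifs
    · simp [mul_sub]
    · simp

theorem uJ_mem (A : uLie n) : uJ n A ∈ uP n := uProj_mem _

theorem uX_coe : (uX n).1 = Matrix.single 0 0 Complex.I := by
  ext i j
  simp only [uX, matT, Matrix.smul_apply, Matrix.add_apply, Matrix.single_apply, smul_eq_mul]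
  split_ifs <;> ring

theorem uXi_apply (A : uLie n) : uXi n A = (A.1 0 0).im := rfl

theorem uJ_apply (A : uLie n) (i j : Fin (n + 1)) :
    (uJ n A).1 i j = if i = 0 ∨ j = 0 then
      (if j = 0 then A.1 i 0 * Complex.I else 0) - (if i = 0 then Complex.I * A.1 0 j else 0)
    else 0 := by
  have h1 : (A.1 * (uX n).1) i j = if j = 0 then A.1 i 0 * Complex.I else 0 := by
    rw [uX_coe]
    split_ifs with h
    · simp [h]
    · simp [h]
  have h2 : ((uX n).1 * A.1) i j = if i = 0 then Complex.I * A.1 0 j else 0 := by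
    rw [uX_coe]
    split_ifs with h
    · simp [h]
    · simp [h]
  rw [← h1, ← h2]
  rfl

theorem uYodd_apply (ν : Fin n) (i j : Fin (n + 1)) : (uYodd ν).1 i j =
    (if ν.succ = i ∧ 0 = j then 1 else 0) - (if 0 = i ∧ ν.succ = j then 1 else 0) := by
  simp only [uYodd, matZ, Matrix.sub_apply, Matrix.single_apply]

theorem uYeven_apply (ν : Fin n) (i j : Fin (n + 1)) : (uYeven ν).1 i j =
    Complex.I * ((if ν.succ = i ∧ 0 = j then 1 else 0) + (if 0 = i ∧ ν.succ = j then 1 else 0)) := by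
  simp only [uYeven, matT, Matrix.smul_apply, Matrix.add_apply, Matrix.single_apply, smul_eq_mul]

theorem uXi_uX : uXi n (uX n) = 1 := by
  rw [uXi_apply, uX_coe]; simp

theorem uXi_uYodd (ν : Fin n) : uXi n (uYodd ν) = 0 := by
  rw [uXi_apply, uYodd_apply]; simp

theorem uXi_uYeven (ν : Fin n) : uXi n (uYeven ν) = 0 := by
  rw [uXi_apply, uYeven_apply]; simp

theorem uJ_uX : uJ n (uX n) = 0 := by
  ext i j
  simp [uJ, uProj, uBracket]

theorem uJ_uYodd (ν : Fin n) : uJ n (uYodd ν) = uYeven ν := by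
  ext i j
  rw [uJ_apply, uYodd_apply, uYodd_apply, uYeven_apply]
  refine Fin.cases ?_ (fun i => ?_) i <;> refine Fin.cases ?_ (fun j => ?_) j <;>
    simp [(Fin.succ_ne_zero _).symm]

theorem uJ_uYeven (ν : Fin n) : uJ n (uYeven ν) = -uYodd ν := by
  ext i j
  rw [uJ_apply, uYeven_apply, uYeven_apply, Submodule.coe_neg, Matrix.neg_apply, uYodd_apply]
  refine Fin.cases ?_ (fun i => ?_) i <;> refine Fin.cases ?_ (fun j => ?_) j <;>
    simp [(Fin.succ_ne_zero _).symm, neg_ite]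

/-- The functional `α₁` on `𝔤`, equal to `κ₁ + ½ ξ₁` if `c ≠ 0`; its values at `X¹`, `X²` are the coefficients of
`U(X¹, ·)`, `U(X², ·)` on the `Y¹_k`. -/
def alpha1 (n p : ℕ) (a c : ℝ) : gLie n p →ₗ[ℝ] ℝ :=
  ((2 - c) / (2 * c)) • (uXi n ∘ₗ LinearMap.fst ℝ _ _) - (a / c) • (uXi p ∘ₗ LinearMap.snd ℝ _ _)

/-- The functional `α₂` on `𝔤`, equal to `κ₂ + ½ ξ₂`; its values at `X¹`, `X²` are the coefficients of
`U(X¹, ·)`, `U(X², ·)` on the `Y²_k`. -/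
def alpha2 (n p : ℕ) (a c : ℝ) : gLie n p →ₗ[ℝ] ℝ :=
  ((a ^ 2 + c ^ 2) / c - 1 / 2) • (uXi p ∘ₗ LinearMap.snd ℝ _ _)
    - (a / c) • (uXi n ∘ₗ LinearMap.fst ℝ _ _)

theorem alpha1_apply (a c : ℝ) (A : gLie n p) :
    alpha1 n p a c A = (2 - c) / (2 * c) * uXi n A.1 - a / c * uXi p A.2 := rfl

theorem alpha2_apply (a c : ℝ) (A : gLie n p) :
    alpha2 n p a c A = ((a ^ 2 + c ^ 2) / c - 1 / 2) * uXi p A.2 - a / c * uXi n A.1 := rfl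

/-- The map `U`, in the form `U(A, B)_j = α_j(A) J(B_j) + α_j(B) J(A_j)`. -/
def uMap (n p : ℕ) (a c : ℝ) : pLie n p →ₗ[ℝ] pLie n p →ₗ[ℝ] pLie n p :=
  LinearMap.mk₂ ℝ (fun X Y =>
    ⟨(alpha1 n p a c X.1 • uJ n Y.1.1 + alpha1 n p a c Y.1 • uJ n X.1.1,
      alpha2 n p a c X.1 • uJ p Y.1.2 + alpha2 n p a c Y.1 • uJ p X.1.2),
      add_mem (Submodule.smul_mem _ _ (uJ_mem _)) (Submodule.smul_mem _ _ (uJ_mem _)),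
      add_mem (Submodule.smul_mem _ _ (uJ_mem _)) (Submodule.smul_mem _ _ (uJ_mem _))⟩)
    (fun X X' Y => Subtype.ext (by
      simp only [Submodule.coe_add, map_add, Prod.fst_add, Prod.snd_add, Prod.mk_add_mk]
      congr 1 <;> module))
    (fun r X Y => Subtype.ext (by
      simp only [Submodule.coe_smul, map_smul, Prod.smul_fst, Prod.smul_snd, Prod.smul_mk,
        smul_eq_mul]
      congr 1 <;> module))
    (fun X Y Y' => Subtype.ext (by
      simp only [Submodule.coe_add, map_add, Prod.fst_add, Prod.snd_add, Prod.mk_add_mk]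
      congr 1 <;> module))
    (fun r X Y => Subtype.ext (by
      simp only [Submodule.coe_smul, map_smul, Prod.smul_fst, Prod.smul_snd, Prod.smul_mk,
        smul_eq_mul]
      congr 1 <;> module))

theorem uMap_apply (a c : ℝ) (X Y : pLie n p) : (uMap n p a c X Y).1 =
    (alpha1 n p a c X.1 • uJ n Y.1.1 + alpha1 n p a c Y.1 • uJ n X.1.1,
      alpha2 n p a c X.1 • uJ p Y.1.2 + alpha2 n p a c Y.1 • uJ p X.1.2) := rfl

theorem isUMap_uMap (a c : ℝ) : IsUMap a c (uMap n p a c) := by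
  have hY : ∀ Y ∈ Yset n p, uXi n Y.1.1 = 0 ∧ uXi p Y.1.2 = 0 := by
    rintro Y (((⟨ν, rfl⟩ | ⟨ν, rfl⟩) | ⟨ν, rfl⟩) | ⟨ν, rfl⟩) <;>
      simp [Y1odd, Y1even, Y2odd, Y2even, uXi_uYodd, uXi_uYeven]
  constructor
  · intro X Y
    apply Subtype.ext
    rw [uMap_apply, uMap_apply]
    congr 1 <;> abel
  case Y_Y =>
    intro Y h Y' h'
    apply Subtype.ext
    simp [uMap_apply, alpha1_apply, alpha2_apply, hY Y h, hY Y' h']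
  all_goals intros; apply Subtype.ext; simp [uMap_apply, alpha1_apply, alpha2_apply, X1, X2,
    Y1odd, Y1even, Y2odd, Y2even, uXi_uX, uXi_uYodd, uXi_uYeven, uJ_uX, uJ_uYodd, uJ_uYeven]
  all_goals module

/-! ### Elements of `𝔭` as operators -/

/-- Only the zeroth row and column of an element of `𝔭` are nonzero. -/
theorem apply_succ_succ_of_mem_uP {A : uLie n} (hA : A ∈ uP n) (i j : Fin n) :
    A.1 i.succ j.succ = 0 := by
  induction hA using Submodule.span_induction with
  | mem B hB =>
    rcases hB with (hB | ⟨ν, rfl⟩) | ⟨ν, rfl⟩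
    · rw [Set.mem_singleton_iff.1 hB]
      simp [uX_coe, (Fin.succ_ne_zero _).symm]
    · simp [uYodd, matZ, (Fin.succ_ne_zero _).symm]
    · simp [uYeven, matT, (Fin.succ_ne_zero _).symm]
  | zero => simp
  | add B C _ _ hB hC => simp [hB, hC]
  | smul r B _ hB => simp [hB]

/-- The vector `e₀`. -/
def e0 (n : ℕ) : CSpace n := EuclideanSpace.single 0 1

theorem matOp_e0 (A : Matrix (Fin (n + 1)) (Fin (n + 1)) ℂ) (i : Fin (n + 1)) :
    matOp A (e0 n) i = A i 0 := by
  simp [matOp_apply, e0]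

theorem inner_e0 (v : CSpace n) : inner ℂ (e0 n) v = v 0 := by
  simp [e0, EuclideanSpace.inner_single_left]

/-! ### Products of elements of `𝔭` at `e₀` -/

theorem uLie_apply_zero_zero (A : uLie n) : A.1 0 0 = uXi n A * Complex.I := by
  have h := congrArg Complex.re (congrFun (congrFun (mem_uLie.1 A.2) 0) 0)
  simp only [conjTranspose_apply, Matrix.neg_apply, Complex.star_def, Complex.conj_re,
    Complex.neg_re] at h
  apply Complex.ext
  · simp; linarith
  · simp [uXi_apply]

theorem matOp_mul (A B : Matrix (Fin (n + 1)) (Fin (n + 1)) ℂ) (v : CSpace n) :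
    matOp (A * B) v = matOp A (matOp B v) := by
  simp [matOp_apply, mulVec_mulVec]

/-- For skew-Hermitian matrices, `(A B)ᴴ = B A`. -/
theorem conj_mul_apply (A B : uLie n) (i j : Fin (n + 1)) :
    (starRingEnd ℂ) ((A.1 * B.1) i j) = (B.1 * A.1) j i := by
  have h : (A.1 * B.1)ᴴ = B.1 * A.1 := by
    rw [conjTranspose_mul, mem_uLie.1 A.2, mem_uLie.1 B.2, neg_mul_neg]
  rw [← h]
  rfl

theorem mul_apply_succ_zero {A : uLie n} (hA : A ∈ uP n) (B : uLie n) (i : Fin n) :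
    (A.1 * B.1) i.succ 0 = A.1 i.succ 0 * B.1 0 0 := by
  rw [Matrix.mul_apply, Fin.sum_univ_succ]
  simp [apply_succ_succ_of_mem_uP hA]

theorem xi_e0 (A : uLie n) : xi (e0 n) (matOp A.1 (e0 n)) = uXi n A := by
  rw [xi_apply, inner_e0, matOp_e0]
  rfl

/-- The tangential part of `A B e₀` is `½ [A, B]_𝔭 e₀` up to terms in `J(A) e₀ = i ζ(A e₀)` and
`J(B) e₀ = i ζ(B e₀)`; the coefficients `r`, `s` make room for the values of `κ_j`. -/
theorem tproj_matOp_e0 {A B : uLie n} (hA : A ∈ uP n) (hB : B ∈ uP n) (r s : ℝ) :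
    tproj (e0 n) (matOp A.1 (matOp B.1 (e0 n)))
        + Complex.I • (r • zeta (e0 n) (matOp B.1 (e0 n)) + s • zeta (e0 n) (matOp A.1 (e0 n)))
      = matOp ((1 / 2 : ℝ) • uProj (uBracket A B)
          + ((r + 1 / 2 * uXi n A) • uJ n B + (s + 1 / 2 * uXi n B) • uJ n A)).1 (e0 n) := by
  have hc := conj_mul_apply A B 0 0
  ext i
  rw [← matOp_mul, matOp_e0, zeta_apply, zeta_apply, tproj_apply, inner_e0, inner_e0, inner_e0]
  simp only [PiLp.add_apply, PiLp.smul_apply, PiLp.sub_apply, matOp_e0, Submodule.coe_add,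
    Submodule.coe_smul, Matrix.add_apply, Matrix.smul_apply, uJ_apply, uProj, uBracket,
    Matrix.of_apply, Matrix.sub_apply]
  -- In the zeroth coordinate, `A B` and `B A` have conjugate entries, so that half of their
  -- difference is the imaginary part of `A B`, which is what the tangential projection keeps.
  refine Fin.cases ?_ (fun i => ?_) i
  · simp [e0, ← hc]
    apply Complex.ext
    · simp
    · simp; ring
  · simp [e0, mul_apply_succ_zero hA, mul_apply_succ_zero hB, uLie_apply_zero_zero]
    ring

/-! ### Transport by a unitary matrix -/

theorem matOp_adU (k : UGrp n) (A : uLie n) (v : CSpace n) :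
    matOp (adU k A).1 (matOp k.1 v) = matOp k.1 (matOp A.1 v) := by
  have hk : (k.1)ᴴ * k.1 = 1 := mem_unitaryGroup_iff'.1 k.2
  rw [← matOp_mul, ← matOp_mul]
  change matOp (k.1 * A.1 * (k.1)ᴴ * k.1) v = _
  rw [Matrix.mul_assoc, hk, Matrix.mul_one]

theorem inner_matOp_unitary (k : UGrp n) (v w : CSpace n) :
    inner ℂ (matOp k.1 v) (matOp k.1 w) = inner ℂ v w := by
  have hk : (k.1)ᴴ * k.1 = 1 := mem_unitaryGroup_iff'.1 k.2
  rw [matOp_apply, matOp_apply, EuclideanSpace.inner_eq_star_dotProduct,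
    EuclideanSpace.inner_eq_star_dotProduct, star_mulVec, dotProduct_comm, ← dotProduct_mulVec,
    mulVec_mulVec, hk, one_mulVec, dotProduct_comm]

theorem matOp_complex_smul (A : Matrix (Fin (n + 1)) (Fin (n + 1)) ℂ) (z : ℂ) (v : CSpace n) :
    matOp A (z • v) = z • matOp A v := by
  simp [matOp_apply, mulVec_smul]

theorem xi_matOp_unitary (k : UGrp n) (x v : CSpace n) :
    xi (matOp k.1 x) (matOp k.1 v) = xi x v := by
  rw [xi_apply, xi_apply, inner_matOp_unitary]

theorem zeta_matOp_unitary (k : UGrp n) (x v : CSpace n) :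
    zeta (matOp k.1 x) (matOp k.1 v) = matOp k.1 (zeta x v) := by
  rw [zeta_apply, zeta_apply, inner_matOp_unitary, map_sub, matOp_complex_smul]

theorem tproj_matOp_unitary (k : UGrp n) (x v : CSpace n) :
    tproj (matOp k.1 x) (matOp k.1 v) = matOp k.1 (tproj x v) := by
  rw [tproj_apply, tproj_apply, inner_matOp_unitary, map_sub, map_smul]

theorem xi_adU (k : UGrp n) (A : uLie n) :
    xi (matOp k.1 (e0 n)) (matOp (adU k A).1 (matOp k.1 (e0 n))) = uXi n A := by
  rw [matOp_adU, xi_matOp_unitary, xi_e0]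

theorem tproj_matOp_adU (k : UGrp n) {A B : uLie n} (hA : A ∈ uP n) (hB : B ∈ uP n) (r s : ℝ)
    {x : CSpace n} (hx : x = matOp k.1 (e0 n)) :
    tproj x (matOp (adU k A).1 (matOp (adU k B).1 x))
        + Complex.I • (r • zeta x (matOp (adU k B).1 x) + s • zeta x (matOp (adU k A).1 x))
      = matOp (adU k ((1 / 2 : ℝ) • uProj (uBracket A B)
          + ((r + 1 / 2 * uXi n A) • uJ n B + (s + 1 / 2 * uXi n B) • uJ n A))).1 x := by
  subst hx
  rw [matOp_adU, matOp_adU, matOp_adU, matOp_adU, tproj_matOp_unitary, zeta_matOp_unitary,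
    zeta_matOp_unitary, ← tproj_matOp_e0 hA hB, map_add, matOp_complex_smul, map_add, map_smul,
    map_smul]

/-! ### The connection on fundamental fields -/

theorem mvfderiv_embField_fund (A : gLie n p) (x : Mfd n p) (u : Tan x) :
    mvfderiv (ModelI n p) (embField (fund A)) x u
      = (matOp A.1.1 (emb x u).1, matOp A.2.1 (emb x u).2) := by
  have hfun : embField (fund A) = (matOp A.1.1).prodMap (matOp A.2.1) ∘ incl :=
    funext fun y => emb_fund A y
  have h := ((matOp A.1.1).prodMap (matOp A.2.1)).hasMFDerivAt.comp x
    (mdifferentiable_incl x).hasMFDerivAt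
  rw [hfun]
  exact congrArg (fun B : Tan x →L[ℝ] CSpace n × CSpace p => B u) h.mfderiv

/-- In `∇_{A*} V - [A*, V]` the derivatives of `V` cancel, and the tangential part of
`A V + Γ(V, A*)` remains. -/
theorem emb_connection_sub_mlieBracket (a c : ℝ) (A : gLie n p) {V : (x : Mfd n p) → Tan x}
    {x : Mfd n p} (hV : DiffAt V x) :
    emb x (connection a c V x (fund A x) - VectorField.mlieBracket (ModelI n p) (fund A) V x)
      = tprojProd x ((matOp A.1.1 (emb x (V x)).1, matOp A.2.1 (emb x (V x)).2)
          + christoffel a c (incl x) (emb x (V x)) (emb x (fund A x))) := by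
  have h := tprojProd_emb x (VectorField.mlieBracket (ModelI n p) (fund A) V x)
  have h2 := mvfderiv_embField_fund A x (V x)
  rw [map_sub, emb_connection, ← h, emb_mlieBracket (diffAt_fund A x) hV, ← map_sub, ← h2]
  congr 1
  have alg : ∀ d g b : CSpace n × CSpace p, d + g - (d - b) = b + g := by intros; abel
  exact alg _ _ _

theorem tproj_I_smul_zeta {x : CSpace n} (hx : ‖x‖ = 1) (v : CSpace n) :
    tproj x (Complex.I • zeta x v) = Complex.I • zeta x v :=
  tproj_eq_self (by rw [inner_smul_right, inner_zeta hx]; simp)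

/-- The explicit connection is the invariant connection of `½ [X, Y]_𝔭 + U(X, Y)`. -/
theorem connection_sub_mlieBracket (a : ℝ) {c : ℝ} (hc : 0 < c) (k : UGrp n × UGrp p)
    (X Y : pLie n p) {V : (x : Mfd n p) → Tan x} (hV : DiffAt V (act k (base n p)))
    (hVY : V (act k (base n p)) = fund (adG k Y.1) (act k (base n p))) :
    connection a c V (act k (base n p)) (fund (adG k X.1) (act k (base n p)))
        - VectorField.mlieBracket (ModelI n p) (fund (adG k X.1)) V (act k (base n p))
      = fund (adG k ((1 / 2 : ℝ) • gProj (gBracket X.1 Y.1) + (uMap n p a c X Y).1))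
          (act k (base n p)) := by
  have e1 : ((act k (base n p)).1 : CSpace n) = matOp k.1.1 (e0 n) := rfl
  have e2 : ((act k (base n p)).2 : CSpace p) = matOp k.2.1 (e0 p) := rfl
  -- Only the coordinates `k e₀` of the point matter from here on.
  generalize act k (base n p) = x at *
  apply emb_injective x
  rw [emb_connection_sub_mlieBracket a c _ hV, hVY, emb_fund, emb_fund, emb_fund]
  have t1 : ∀ A : gLie n p, xi (x.1 : CSpace n) (matOp (adG k A).1.1 (x.1 : CSpace n))
      = uXi n A.1 := fun A => by rw [e1]; exact xi_adU k.1 A.1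
  have t2 : ∀ A : gLie n p, xi (x.2 : CSpace p) (matOp (adG k A).2.1 (x.2 : CSpace p))
      = uXi p A.2 := fun A => by rw [e2]; exact xi_adU k.2 A.2
  have k1 : ∀ A : gLie n p, kappa1 a c (incl x) (matOp (adG k A).1.1 (x.1 : CSpace n),
      matOp (adG k A).2.1 (x.2 : CSpace p)) + 1 / 2 * uXi n A.1 = alpha1 n p a c A := fun A => by
    rw [kappa1_apply, alpha1_apply, ← t1, ← t2]
    simp only [incl]
    field_simp
    ring
  have k2 : ∀ A : gLie n p, kappa2 a c (incl x) (matOp (adG k A).1.1 (x.1 : CSpace n),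
      matOp (adG k A).2.1 (x.2 : CSpace p)) + 1 / 2 * uXi p A.2 = alpha2 n p a c A := fun A => by
    rw [kappa2_apply, alpha2_apply, ← t1, ← t2]
    simp only [incl]
    ring
  -- The identity `κ_j + ½ ξ_j = α_j` turns the two factors of the claim into instances of
  -- `tproj_matOp_adU`.
  have h1 := tproj_matOp_adU k.1 X.2.1 Y.2.1 (kappa1 a c (incl x)
    (matOp (adG k X.1).1.1 (x.1 : CSpace n), matOp (adG k X.1).2.1 (x.2 : CSpace p)))
    (kappa1 a c (incl x)
    (matOp (adG k Y.1).1.1 (x.1 : CSpace n), matOp (adG k Y.1).2.1 (x.2 : CSpace p))) e1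
  have h2 := tproj_matOp_adU k.2 X.2.2 Y.2.2 (kappa2 a c (incl x)
    (matOp (adG k X.1).1.1 (x.1 : CSpace n), matOp (adG k X.1).2.1 (x.2 : CSpace p)))
    (kappa2 a c (incl x)
    (matOp (adG k Y.1).1.1 (x.1 : CSpace n), matOp (adG k Y.1).2.1 (x.2 : CSpace p))) e2
  rw [k1, k1] at h1
  rw [k2, k2] at h2
  have i1 : ∀ (r : ℝ) v, tproj (x.1 : CSpace n) (Complex.I • r • zeta (x.1 : CSpace n) v)
      = Complex.I • r • zeta (x.1 : CSpace n) v := fun r v => by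
    rw [← map_smul, tproj_I_smul_zeta (norm_fst x)]
  have i2 : ∀ (r : ℝ) v, tproj (x.2 : CSpace p) (Complex.I • r • zeta (x.2 : CSpace p) v)
      = Complex.I • r • zeta (x.2 : CSpace p) v := fun r v => by
    rw [← map_smul, tproj_I_smul_zeta (norm_snd x)]
  refine Prod.ext ?_ ?_
  · refine Eq.trans ?_ h1
    rw [christoffel_apply]
    change tproj (x.1 : CSpace n) (_ + Complex.I • (_ • zeta (x.1 : CSpace n) _
      + _ • zeta (x.1 : CSpace n) _)) = _
    rw [map_add, smul_add, map_add, i1, i1, smul_add]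
    rfl
  · refine Eq.trans ?_ h2
    rw [christoffel_apply]
    change tproj (x.2 : CSpace p) (_ + Complex.I • (_ • zeta (x.2 : CSpace p) _
      + _ • zeta (x.2 : CSpace p) _)) = _
    rw [map_add, smul_add, map_add, i2, i2, smul_add]
    rfl

end SphereProduct

end

theorem proposition1 (n p : ℕ) (a c : ℝ) (hc : 0 < c) :
    ∃ U : SphereProduct.pLie n p →ₗ[ℝ] SphereProduct.pLie n p →ₗ[ℝ] SphereProduct.pLie n p,
      SphereProduct.IsUMap a c U ∧
      (∃ D : SphereProduct.Connection n p,
        SphereProduct.IsRiemannianConnection (SphereProduct.metric a c) D) ∧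
      ∀ D : SphereProduct.Connection n p,
        SphereProduct.IsRiemannianConnection (SphereProduct.metric a c) D →
        SphereProduct.IsInvariantConnectionOf
          (fun X Y => (1 / 2 : ℝ) • SphereProduct.gProj (SphereProduct.gBracket X.1 Y.1)
            + (U X Y).1) D := by
  refine ⟨SphereProduct.uMap n p a c, SphereProduct.isUMap_uMap a c,
    ⟨_, SphereProduct.isRiemannianConnection_connection a c⟩, fun D hD k X Y V hV hVY => ?_⟩
  rw [hD.apply_eq hc (SphereProduct.isRiemannianConnection_connection a c) hV]
  exact SphereProduct.connection_sub_mlieBracket a hc k X Y hV hVY
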